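/- Define functions $\gamma,q$ on $\{0,1,2,\dots\}$ by $\gamma(0)=q(0)=0$ and, for $m\ge 1$, $$\gamma(m)=2^m(m+1)+\sum_{k=1}^{m-1}\gamma(k)\binom{m+1}{m-k},\qquad q(m)=2^m(m-1)+1+\sum_{k=1}^{m-1}q(k)\binom{m+1}{m-k}.$$ For $m=0,\dots,7$ their values are $\gamma(m)=0,4,24,152,1120,9732,98336,1135024$ and $q(m)=0,1,8,55,414,3613,36532,421699$. Notation. For a group $G$, $BG$ is the simplicial set whose $m$-simplices are the tuples $[g_1,\dots,g_m]$ of elements of $G$, with faces $d_0[g_1,\dots,g_m]=[g_2,\dots,g_m]$, $d_i[g_1,\dots,g_m]=[g_1,\dots,g_ig_{i+1},\dots,g_m]$ for $0<i<m$, $d_m[g_1,\dots,g_m]=[g_1,\dots,g_{m-1}]$, and degeneracies $s_i[g_1,\dots,g_m]=[g_1,\dots,g_i,e,g_{i+1},\dots,g_m]$; a simplex is degenerate if it is of the form $s_i\tau$. $\mathbb{Z}BG_*$ is the chain complex of the free abelian groups on the $m$-simplices of $BG$ with boundary $\partial=\sum_i(-1)^id_i$. The diameter $d(c)$ of a chain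 $c=\sum_\sigma n_\sigma\sigma$ is $\sum_\sigma|n_\sigma|$. The mitosis of $G$ is $\mathcal{A}(G)=\langle G,u,t\mid a^t=a\cdot a^u,\ [a^u,b]\ (a,b\in G)\rangle$, where $a^b=bab^{-1}$; $\mathcal{A}^0(G)=G$, $\mathcal{A}^{n+1}(G)=\mathcal{A}(\mathcal{A}^n(G))$, and $i_G^n\colon G\to\mathcal{A}^n(G)$ is the composition of the canonical homomorphisms $G\to\mathcal{A}(G)\to\cdots\to\mathcal{A}^n(G)$. We write $e\colon G\to\mathcal{A}^n(G)$ for the trivial homomorphism, and denote a homomorphism and the chain map it induces by the same letter. Theorem. For every group $G$ and every integer $n\ge 0$ there is a partial chain homotopy $\Psi=\Psi_G^n$ of dimension $n$ between the chain maps $e,i_G^n\colon\mathbb{Z}BG_*\to\mathbb{Z}B\mathcal{A}^n(G)_*$, that is, homomorphisms $\Psi_m\colon\mathbb{Z}BG_m\to\mathbb{Z}B\mathcal{A}^n(G)_{m+1}$ for $0\le m\le n$ with $\partial\Psi+\Psi\partial=i_G^n-e$ in all dimensions $\le n$, such that 1. the diameter function of $\Psi$ is exactly $\gamma$: for every $m\le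 n$, the maximum of $d(\Psi(\sigma))$ over all simplices $\sigma$ of $BG$ of dimension at most $m$ exists and equals $\gamma(m)$; 2. for every $m\le n$ and every $m$-simplex $\sigma$ of $BG$, the chain $\Psi(\sigma)$ contains at least $q(m)$ degenerate $(m+1)$-simplices, counted with multiplicity: if $\Psi(\sigma)=\sum_\tau n_\tau\tau$, then $\sum_{\tau\text{ degenerate}}|n_\tau|\ge q(m)$. -/

import Mathlib

universe u

/-! ### The simplicial classifying space of a group -/

/-- The `n`-simplices `[g₁, …, gₙ]` of the simplicial classifying space `BG`. -/
abbrev BSimplex (G : Type u) (n : ℕ) : Type u := Fin n → G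

/-- The face functions of `BG`: `d₀` drops the first component, `dᵢ` for `0 < i < n + 1`
multiplies the `i`-th and the `(i+1)`-st components, and `d₍ₙ₊₁₎` drops the last component
(`Fin.contractNth (Fin.last n)` drops the last entry). -/
def bFace {G : Type u} [Group G] {n : ℕ} (i : Fin (n + 2)) (σ : BSimplex G (n + 1)) :
    BSimplex G n :=
  Fin.cases (motive := fun _ => BSimplex G n) (Fin.tail σ)
    (fun j => Fin.contractNth j (fun a b => a * b) σ) i

/-- The degeneracy functions of `BG`:
`sᵢ [g₁, …, gₙ] = [g₁, …, gᵢ, e, gᵢ₊₁, …, gₙ]` for `0 ≤ i ≤ n`. -/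
def bDegen {G : Type u} [Group G] {n : ℕ} (i : Fin (n + 1)) (σ : BSimplex G n) :
    BSimplex G (n + 1) :=
  Fin.insertNth (α := fun _ => G) i 1 σ

/-- A simplex of `BG` of positive dimension is degenerate if it lies in the image of some
degeneracy function. -/
def IsDegenerate {G : Type u} [Group G] {n : ℕ} (σ : BSimplex G (n + 1)) : Prop :=
  ∃ (i : Fin (n + 1)) (τ : BSimplex G n), σ = bDegen i τ

/-! ### The Moore complex `ℤBG` -/

/-- The free abelian group `ℤBGₙ` on the `n`-simplices of `BG`. -/
abbrev BChain (G : Type u) (n : ℕ) : Type u := BSimplex G n →₀ ℤ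

/-- The boundary operator `∂ = ∑ᵢ (-1)ⁱ dᵢ : ℤBGₙ₊₁ → ℤBGₙ`
(the boundary operator on `ℤBG₀` is zero). -/
noncomputable def bBoundary (G : Type u) [Group G] (n : ℕ) :
    BChain G (n + 1) →ₗ[ℤ] BChain G n :=
  ∑ i : Fin (n + 2), (-1 : ℤ) ^ (i : ℕ) • Finsupp.lmapDomain ℤ ℤ (bFace (G := G) i)

/-- The map `ℤBGₙ → ℤBHₙ` induced by a group homomorphism `f : G → H`. -/
noncomputable def bMap {G H : Type u} [Group G] [Group H] (f : G →* H) (n : ℕ) :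
    BChain G n →ₗ[ℤ] BChain H n :=
  Finsupp.lmapDomain ℤ ℤ (fun σ : BSimplex G n => fun k => f (σ k))

/-- The diameter of a chain: the `L¹`-norm `∑ |n_α|` of its coefficients. -/
noncomputable def chainDiam {G : Type u} {n : ℕ} (c : BChain G n) : ℕ :=
  c.sum fun _ a => a.natAbs

open Classical in
/-- The number of degenerate simplices in a chain, counted with multiplicity: the diameter of
the part of the chain that is supported on degenerate simplices. -/
noncomputable def degenerateCount {G : Type u} [Group G] {n : ℕ} (c : BChain G (n + 1)) : ℕ :=
  chainDiam (c.filter fun σ => IsDegenerate σ)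

/-! ### Partial chain homotopies -/

/-- A partial chain homotopy of dimension `n` from `f` to `g` (as chain maps `ℤBG → ℤBH`):
homomorphisms `Pₘ : ℤBGₘ → ℤBHₘ₊₁`, defined for `m ≤ n` only, with `∂P + P∂ = g - f` in all
dimensions `m ≤ n`. -/
structure PartialChainHomotopy {G H : Type u} [Group G] [Group H] (f g : G →* H) (n : ℕ) where
  /-- the homomorphism in dimension `m ≤ n` -/
  map : ∀ m : ℕ, m ≤ n → (BChain G m →ₗ[ℤ] BChain H (m + 1))
  zero_comm : bBoundary H 0 ∘ₗ map 0 (Nat.zero_le n) = bMap g 0 - bMap f 0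
  succ_comm : ∀ (m : ℕ) (hm : m + 1 ≤ n),
    bBoundary H (m + 1) ∘ₗ map (m + 1) hm
      + map m ((Nat.le_succ m).trans hm) ∘ₗ bBoundary G m
      = bMap g (m + 1) - bMap f (m + 1)

/-- The value `P(σ)` of a partial chain homotopy on a basis element `σ`. -/
noncomputable def PartialChainHomotopy.onSimplex {G H : Type u} [Group G] [Group H]
    {f g : G →* H} {n : ℕ} (P : PartialChainHomotopy f g n) (m : ℕ) (hm : m ≤ n)
    (σ : BSimplex G m) : BChain H (m + 1) :=
  P.map m hm (Finsupp.single σ 1)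

/-- `P.HasDiameter k hk d` says that the diameter function of `P` takes the value `d` at `k ≤ n`:
`d` is the maximum of the diameters of `P(σ)` over all simplices `σ` of dimension at most `k`. -/
def PartialChainHomotopy.HasDiameter {G H : Type u} [Group G] [Group H]
    {f g : G →* H} {n : ℕ} (P : PartialChainHomotopy f g n) (k : ℕ) (hk : k ≤ n) (d : ℕ) : Prop :=
  IsGreatest {r : ℕ | ∃ (i : ℕ) (hi : i ≤ k) (σ : BSimplex G i),
    r = chainDiam (P.onSimplex i (hi.trans hk) σ)} d

/-! ### Mitosis -/

/-- The free product of `G` with the free group on `u` (`false`) and `t` (`true`). -/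
abbrev MitosisFree (G : Type u) [Group G] : Type u := Monoid.Coprod G (FreeGroup Bool)

/-- An element of `G` in `G * ⟨u, t⟩`. -/
def mitosisBase (G : Type u) [Group G] : G →* MitosisFree G := Monoid.Coprod.inl

/-- The new generator `u`. -/
def mitosisU (G : Type u) [Group G] : MitosisFree G := Monoid.Coprod.inr (FreeGroup.of false)

/-- The new generator `t`. -/
def mitosisT (G : Type u) [Group G] : MitosisFree G := Monoid.Coprod.inr (FreeGroup.of true)

/-- The conjugate `x ^ y = y x y⁻¹`. -/
def conjBy {H : Type u} [Group H] (x y : H) : H := y * x * y⁻¹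

/-- The commutator `[x, y] = x y x⁻¹ y⁻¹`. -/
def commOf {H : Type u} [Group H] (x y : H) : H := x * y * x⁻¹ * y⁻¹

/-- The relators `a ^ t = a · a ^ u` and `[a ^ u, b]` for all `a, b ∈ G`. -/
def mitosisRels (G : Type u) [Group G] : Set (MitosisFree G) :=
  {r | ∃ a : G, r = conjBy (mitosisBase G a) (mitosisT G) *
      (mitosisBase G a * conjBy (mitosisBase G a) (mitosisU G))⁻¹} ∪
  {r | ∃ a b : G, r = commOf (conjBy (mitosisBase G a) (mitosisU G)) (mitosisBase G b)}

/-- The mitosis `𝒜(G) = ⟨G, u, t ∣ a ^ t = a · a ^ u, [a ^ u, b] for all a, b ∈ G⟩`. -/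
abbrev Mitosis (G : Type u) [Group G] : Type u :=
  MitosisFree G ⧸ Subgroup.normalClosure (mitosisRels G)

/-- The canonical homomorphism `k_G : G → 𝒜(G)`. -/
def mitosisHom (G : Type u) [Group G] : G →* Mitosis G :=
  (QuotientGroup.mk' (Subgroup.normalClosure (mitosisRels G))).comp (mitosisBase G)

/-- The `n`-th mitosis `𝒜ⁿ(G)`: `𝒜⁰(G) = G` and `𝒜ⁿ⁺¹(G) = 𝒜(𝒜ⁿ(G))`. -/
def mitosisIter (G : Type u) [Group G] : ℕ → GrpCat.{u}
  | 0 => GrpCat.of G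
  | n + 1 => GrpCat.of (Mitosis (mitosisIter G n))

/-- The `n`-th mitosis embedding `i_Gⁿ : G → 𝒜ⁿ(G)`, the composition of the canonical
homomorphisms `G → 𝒜(G) → ⋯ → 𝒜ⁿ(G)`. -/
def mitosisEmb (G : Type u) [Group G] : (n : ℕ) → (G →* mitosisIter G n)
  | 0 => MonoidHom.id G
  | n + 1 => (mitosisHom (mitosisIter G n)).comp (mitosisEmb G n)

/-! ### The counting functions -/

/-- `γ(0) = 0` and `γ(m) = 2ᵐ (m + 1) + ∑_{k=1}^{m-1} γ(k) C(m + 1, m - k)` for `m ≥ 1`. -/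
def gammaFn : ℕ → ℕ
  | 0 => 0
  | m + 1 => 2 ^ (m + 1) * (m + 2) +
      ∑ k : Fin m, gammaFn (k.val + 1) * Nat.choose (m + 2) (m - k.val)
decreasing_by exact Nat.succ_lt_succ k.isLt

/-- `q(0) = 0` and `q(m) = 2ᵐ (m - 1) + 1 + ∑_{k=1}^{m-1} q(k) C(m + 1, m - k)` for `m ≥ 1`. -/
def qFn : ℕ → ℕ
  | 0 => 0
  | m + 1 => 2 ^ (m + 1) * m + 1 +
      ∑ k : Fin m, qFn (k.val + 1) * Nat.choose (m + 2) (m - k.val)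
decreasing_by exact Nat.succ_lt_succ k.isLt

/-! Write `α` for the canonical map `K → 𝒜(K)`, `β` for its conjugate by `u`, and `γ` for its
conjugate by `t`. The relations say that `α` and `β` commute and `γ = α · β`. Suppose `Θ` contracts
`j : G → K` in positive dimensions up to `n`. In 𝒜(K), the Eilenberg–Zilber homotopy joins `γ ∘ j`
to the shuffle product of the Alexander–Whitney splitting (`bd_ez`). The prism of `t u⁻¹` joins `γ ∘
j` to `β ∘ j` (`bd_prism`). Shuffling `Θ` of front faces with back faces removes every term of the
splitting except the two extreme ones, `α ∘ j` and `β ∘ j` (`bd_frontShuffleList`). The combination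
contracts `α ∘ j` one dimension further (`bd_stepHomotopy`).

Counting terms before cancellation gives `2 ^ (m + 1) - 1` from the first two homotopies and a
binomial sum from the third. This is exactly the recurrence of `γ(m) - q(m)` (`excessFn_succ`).
Cancellation may make the true maximum `μ(m)` smaller, but on every simplex it preserves parity.

The trivial map is contracted by constant chains on degenerate simplices (`bd_lin_pad`), whose
diameters `d(m)` can be prescribed if they increase and are odd for odd `m` (`chainDiam_pad`). Take
`d = γ - μ`: then `d ≥ q`, the parity follows from `odd_qFn`, and monotonicity from
`gammaFn_le_qFn_succ`. The padding uses the entries `t²` and `t³`, while all entries of `Θ` have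
`t`-exponent 0 or 1. So the supports are disjoint and diameters add, with maximum exactly `γ(m)`. -/

/-! ### Chains on lists -/

/-- The free abelian group on the lists of elements of `K`, i.e. on the simplices of `BK` of all
dimensions. -/
abbrev ListChain (K : Type*) : Type _ := List K →₀ ℤ

namespace ListChain

variable {K A M : Type*} [AddCommGroup M]

/-- The basis element of a list. -/
noncomputable def of (l : List K) : ListChain K := Finsupp.single l 1

/-- The linear extension of a function on lists. -/
noncomputable def lin (F : List K → M) : ListChain K →ₗ[ℤ] M := Finsupp.linearCombination ℤ F

@[simp] theorem lin_of (F : List K → M) (l : List K) : lin F (of l) = F l := by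
  simp [lin, of]

theorem hom_ext {f g : ListChain K →ₗ[ℤ] M} (h : ∀ l, f (of l) = g (of l)) : f = g :=
  Finsupp.lhom_ext' fun l => LinearMap.ext_ring (h l)

theorem lin_add (F F' : List K → M) (c : ListChain K) :
    lin (fun l => F l + F' l) c = lin F c + lin F' c := by
  have : lin (fun l => F l + F' l) = lin F + lin F' := hom_ext fun l => by simp
  simp [this]

/-- Prepend an element to every list. -/
noncomputable def cons (g : K) : ListChain K →ₗ[ℤ] ListChain K := lin fun l => of (g :: l)

@[simp] theorem cons_of (g : K) (l : List K) : cons g (of l) = of (g :: l) := lin_of _ _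

theorem lin_cons (F : List K → M) (g : K) (c : ListChain K) :
    lin F (cons g c) = lin (fun l => F (g :: l)) c := by
  have : lin F ∘ₗ cons g = lin (fun l => F (g :: l)) := hom_ext fun l => by simp
  exact LinearMap.congr_fun this c

/-- Apply a function to all entries. -/
noncomputable def map (f : K → A) : ListChain K →ₗ[ℤ] ListChain A := lin fun l => of (l.map f)

@[simp] theorem map_of (f : K → A) (l : List K) : map f (of l) = of (l.map f) := lin_of _ _

theorem map_cons (f : K → A) (g : K) (c : ListChain K) :
    map f (cons g c) = cons (f g) (map f c) := by
  have : map f ∘ₗ cons g = cons (f g) ∘ₗ map f := hom_ext fun l => by simp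
  exact LinearMap.congr_fun this c

/-- The sign involution, multiplication by `(-1)ᵐ` on lists of length `m`. -/
noncomputable def sgn : ListChain K →ₗ[ℤ] ListChain K := lin fun l => (-1 : ℤ) ^ l.length • of l

@[simp] theorem sgn_of (l : List K) : sgn (of l) = (-1 : ℤ) ^ l.length • of l := lin_of _ _

theorem sgn_cons (g : K) (c : ListChain K) : sgn (cons g c) = - cons g (sgn c) := by
  have : sgn ∘ₗ cons g = - (cons g ∘ₗ sgn) := hom_ext fun l => by simp [pow_succ]
  exact LinearMap.congr_fun this c

/-- The face `d₀`, with value zero on the empty list. -/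
noncomputable def tail : ListChain K →ₗ[ℤ] ListChain K :=
  lin fun l => match l with
    | [] => 0
    | _ :: l => of l

@[simp] theorem tail_of_nil : tail (of ([] : List K)) = 0 := lin_of _ _
@[simp] theorem tail_of_cons (g : K) (l : List K) : tail (of (g :: l)) = of l := lin_of _ _
@[simp] theorem tail_cons (g : K) (c : ListChain K) : tail (cons g c) = c := by
  have : tail ∘ₗ cons g = LinearMap.id := hom_ext fun l => by simp
  exact LinearMap.congr_fun this c

/-- The projection that kills the empty list. -/
noncomputable def positive : ListChain K →ₗ[ℤ] ListChain K :=
  lin fun l => match l with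
    | [] => 0
    | g :: l => of (g :: l)

@[simp] theorem positive_of_nil : positive (of ([] : List K)) = 0 := lin_of _ _
@[simp] theorem positive_of_cons (g : K) (l : List K) :
    positive (of (g :: l)) = of (g :: l) := lin_of _ _
@[simp] theorem positive_cons (g : K) (c : ListChain K) : positive (cons g c) = cons g c := by
  have : positive ∘ₗ cons g = cons g := hom_ext fun l => by simp
  exact LinearMap.congr_fun this c

theorem map_tail (f : K → A) (c : ListChain K) : map f (tail c) = tail (map f c) := by
  have : map f ∘ₗ tail = tail ∘ₗ map f := hom_ext fun l => by cases l <;> simp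
  exact LinearMap.congr_fun this c

theorem map_positive (f : K → A) (c : ListChain K) :
    map f (positive c) = positive (map f c) := by
  have : map f ∘ₗ positive = positive ∘ₗ map f := hom_ext fun l => by cases l <;> simp
  exact LinearMap.congr_fun this c

/-! ### Faces and the boundary operator on lists. -/

variable [Group K] [Group A]

/-- Multiply the first entry of a list from the left; the empty list is fixed. -/
def mulHeadList (g : K) : List K → List K
  | [] => []
  | h :: l => (g * h) :: l

-- With this convention the last face, which drops an entry, is also a multiplication into the rest
-- of the list, so `innerList` needs no separate case for it.
@[simp] theorem mulHeadList_nil (g : K) : mulHeadList g [] = [] := rfl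
@[simp] theorem mulHeadList_cons (g h : K) (l : List K) :
    mulHeadList g (h :: l) = (g * h) :: l := rfl
@[simp] theorem length_mulHeadList (g : K) (l : List K) :
    (mulHeadList g l).length = l.length := by cases l <;> rfl
@[simp] theorem mulHeadList_one (l : List K) : mulHeadList 1 l = l := by cases l <;> simp
theorem map_mulHeadList (f : K →* A) (g : K) (l : List K) :
    (mulHeadList g l).map f = mulHeadList (f g) (l.map f) := by cases l <;> simp

/-- Multiply the first entry from the left. -/
noncomputable def mulHead (g : K) : ListChain K →ₗ[ℤ] ListChain K :=
  lin fun l => of (mulHeadList g l)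

@[simp] theorem mulHead_of (g : K) (l : List K) : mulHead g (of l) = of (mulHeadList g l) :=
  lin_of _ _

@[simp] theorem mulHead_cons (g h : K) (c : ListChain K) :
    mulHead g (cons h c) = cons (g * h) c := by
  have : mulHead g ∘ₗ cons h = cons (g * h) := hom_ext fun l => by simp
  exact LinearMap.congr_fun this c

/-- The alternating sum of the faces `dᵢ` with `i ≥ 1` of a list. -/
noncomputable def innerList : List K → ListChain K
  | [] => 0
  | g :: l => - of (mulHeadList g l) - cons g (innerList l)

/-- The alternating sum of the faces `dᵢ` with `i ≥ 1`. -/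
noncomputable def inner : ListChain K →ₗ[ℤ] ListChain K := lin innerList

@[simp] theorem inner_of_nil : inner (of ([] : List K)) = 0 := lin_of _ _
@[simp] theorem inner_of_cons (g : K) (l : List K) :
    inner (of (g :: l)) = - of (mulHeadList g l) - cons g (inner (of l)) := by
  simp [inner, innerList]
@[simp] theorem inner_cons (g : K) (c : ListChain K) :
    inner (cons g c) = - mulHead g c - cons g (inner c) := by
  have : inner ∘ₗ cons g = - mulHead g - cons g ∘ₗ inner := hom_ext fun l => by simp
  exact LinearMap.congr_fun this c

theorem map_inner (f : K →* A) (c : ListChain K) : map f (inner c) = inner (map f c) := by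
  have : map f ∘ₗ inner = inner ∘ₗ map f := hom_ext fun l => by
    induction l with
    | nil => simp
    | cons g l ih =>
      simp only [LinearMap.comp_apply] at ih
      simp [map_cons, ih, map_mulHeadList]
  exact LinearMap.congr_fun this c

theorem sgn_inner (c : ListChain K) : sgn (inner c) = - inner (sgn c) := by
  have : sgn ∘ₗ inner = - (inner ∘ₗ (sgn : ListChain K →ₗ[ℤ] _)) := hom_ext fun l => by
    induction l with
    | nil => simp
    | cons g l ih =>
      simp only [LinearMap.comp_apply, LinearMap.neg_apply] at ih
      simp only [inner_of_cons, map_sub, map_neg, sgn_of, length_mulHeadList, sgn_cons, ih,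
        map_smul, List.length_cons, pow_succ, LinearMap.comp_apply, LinearMap.neg_apply]
      module
  exact LinearMap.congr_fun this c

/-- The boundary operator. -/
noncomputable def bd : ListChain K →ₗ[ℤ] ListChain K := tail + inner

theorem bd_apply (c : ListChain K) : bd c = tail c + inner c := rfl

theorem map_bd (f : K →* A) (c : ListChain K) : map f (bd c) = bd (map f c) := by
  simp [bd_apply, map_inner, map_tail]

theorem bd_of_singleton (g : K) : bd (of [g]) = 0 := by simp [bd_apply]

/-- The two faces of a 1-simplex cancel, so no boundary meets the empty list. With `bd_positive`,
this lets back faces be truncated to positive dimension without spoiling boundary formulas. -/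
theorem positive_bd (c : ListChain K) : positive (bd c) = bd c := by
  have : positive ∘ₗ bd = (bd : ListChain K →ₗ[ℤ] _) := hom_ext fun l => by
    match l with
    | [] => simp [bd_apply]
    | [g] => simp [bd_of_singleton]
    | g :: h :: l => simp [bd_apply]
  exact LinearMap.congr_fun this c

theorem bd_positive (c : ListChain K) : bd (positive c) = bd c := by
  have : bd ∘ₗ positive = (bd : ListChain K →ₗ[ℤ] _) := hom_ext fun l => by
    cases l <;> simp [bd_apply]
  exact LinearMap.congr_fun this c

/-! ### Shuffles -/

section Shuffle

variable (α β : K →* A)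

/-- The signed sum of the shuffles of the lists `α p` and `β q`. -/
noncomputable def shuffleList : List K → List K → ListChain A
  | [], q => of (q.map β)
  | x :: p, [] => of ((x :: p).map α)
  | x :: p, y :: q => cons (α x) (shuffleList p (y :: q)) +
      (-1 : ℤ) ^ (p.length + 1) • cons (β y) (shuffleList (x :: p) q)
termination_by p q => p.length + q.length

@[simp] theorem shuffleList_nil (q : List K) : shuffleList α β [] q = of (q.map β) := by
  rw [shuffleList]

@[simp] theorem shuffleList_nil_right (p : List K) :
    shuffleList α β p [] = of (p.map α) := by
  cases p <;> rw [shuffleList]; rfl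

theorem shuffleList_cons_cons (x y : K) (p q : List K) :
    shuffleList α β (x :: p) (y :: q) = cons (α x) (shuffleList α β p (y :: q)) +
      (-1 : ℤ) ^ (p.length + 1) • cons (β y) (shuffleList α β (x :: p) q) := by
  rw [shuffleList]

/-- The shuffle product. -/
noncomputable def shuffle : ListChain K →ₗ[ℤ] ListChain K →ₗ[ℤ] ListChain A :=
  lin fun p => lin (shuffleList α β p)

@[simp] theorem shuffle_of (p q : List K) :
    shuffle α β (of p) (of q) = shuffleList α β p q := by simp [shuffle]

theorem shuffle_nil_left (c : ListChain K) : shuffle α β (of []) c = map β c := by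
  have : shuffle α β (of []) = map β := hom_ext fun l => by simp
  simp [this]

theorem shuffle_nil_right (c : ListChain K) : shuffle α β c (of []) = map α c := by
  have : (shuffle α β).flip (of []) = map α := hom_ext fun l => by simp
  exact LinearMap.congr_fun this c

theorem shuffle_cons_left (x y : K) (c : ListChain K) (q : List K) :
    shuffle α β (cons x c) (of (y :: q)) = cons (α x) (shuffle α β c (of (y :: q))) -
      cons (β y) (shuffle α β (cons x (sgn c)) (of q)) := by
  have : (shuffle α β).flip (of (y :: q)) ∘ₗ cons x =
      cons (α x) ∘ₗ (shuffle α β).flip (of (y :: q)) -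
        cons (β y) ∘ₗ (shuffle α β).flip (of q) ∘ₗ cons x ∘ₗ sgn := hom_ext fun l => by
    simp [shuffleList_cons_cons, pow_succ, sub_eq_add_neg]
  exact LinearMap.congr_fun this c

theorem shuffle_cons_right (x y : K) (p : List K) (c : ListChain K) :
    shuffle α β (of (x :: p)) (cons y c) = cons (α x) (shuffle α β (of p) (cons y c)) +
      (-1 : ℤ) ^ (p.length + 1) • cons (β y) (shuffle α β (of (x :: p)) c) := by
  have : shuffle α β (of (x :: p)) ∘ₗ cons y =
      cons (α x) ∘ₗ shuffle α β (of p) ∘ₗ cons y +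
        (-1 : ℤ) ^ (p.length + 1) • cons (β y) ∘ₗ shuffle α β (of (x :: p)) :=
    hom_ext fun l => by simp [shuffleList_cons_cons]
  exact LinearMap.congr_fun this c

theorem tail_shuffleList (p q : List K) :
    tail (shuffleList α β p q) = shuffle α β (tail (of p)) (of q) +
      (-1 : ℤ) ^ p.length • shuffle α β (of p) (tail (of q)) := by
  match p, q with
  | [], q => simp [shuffle_nil_left, map_tail]
  | x :: p, [] => simp
  | x :: p, y :: q => simp [shuffleList_cons_cons]

/-- Isolates the face that multiplies the leading `α x` into a following `β y`. The mirror statement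
isolates `β y` times `α x`; in the Leibniz rule the two cancel. -/
theorem mulHead_shuffleList_left (x y : K) (p q : List K) :
    shuffleList α β (mulHeadList x p) (y :: q) - mulHead (α x) (shuffleList α β p (y :: q)) +
      (-1 : ℤ) ^ (p.length + 1) • cons (β y) (shuffleList α β (mulHeadList x p) q) =
    (-1 : ℤ) ^ (p.length + 1) • cons (α x * β y) (shuffleList α β p q) := by
  cases p with
  | nil => simp; abel
  | cons z p => simp [shuffleList_cons_cons, pow_succ]

theorem mulHead_shuffleList_right (x y : K) (p q : List K) (hg : Commute (α x) (β y)) :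
    shuffleList α β (x :: p) (mulHeadList y q) - mulHead (β y) (shuffleList α β (x :: p) q) -
      cons (α x) (shuffleList α β p (mulHeadList y q)) =
    - cons (α x * β y) (shuffleList α β p q) := by
  cases q with
  | nil => simp [hg.eq]
  | cons z q => simp [shuffleList_cons_cons, hg.eq]

variable {α β}

/-- A face that multiplies two neighbours from the same word is a face of that word. Mixed
neighbours occur in both orders with opposite signs, and these faces agree because `α` and `β`
commute. -/
theorem inner_shuffleList (hc : ∀ x y, Commute (α x) (β y)) (p q : List K) :
    inner (shuffleList α β p q) = shuffle α β (inner (of p)) (of q) +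
      (-1 : ℤ) ^ p.length • shuffle α β (of p) (inner (of q)) := by
  match p, q with
  | [], q => simp [shuffle_nil_left, map_inner]
  | x :: p, [] =>
    rw [shuffle_nil_right, map_inner]; simp
  | x :: p, y :: q =>
    have h1 := inner_shuffleList hc p (y :: q)
    have h2 := inner_shuffleList hc (x :: p) q
    have h3 := mulHead_shuffleList_left α β x y p q
    have h4 := mulHead_shuffleList_right α β x y p q (hc x y)
    have hs : ((-1 : ℤ) ^ p.length) * ((-1 : ℤ) ^ p.length) = 1 := by
      rw [← mul_pow]; simp
    have h5 : sgn (inner (of p)) = - ((-1 : ℤ) ^ p.length • inner (of p)) := by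
      rw [sgn_inner]; simp
    simp only [shuffleList_cons_cons, map_add, map_smul, inner_cons, h1, h2,
      inner_of_cons, map_sub, map_neg, LinearMap.sub_apply, LinearMap.neg_apply,
      shuffle_of, shuffle_cons_left, shuffle_cons_right, h5, smul_sub, smul_add, smul_neg,
      LinearMap.smul_apply, List.length_cons, pow_succ, mul_neg, mul_one, neg_smul, smul_smul, hs,
      one_smul, neg_neg] at h3 h4 ⊢
    rcases neg_one_pow_eq_or ℤ p.length with h | h <;>
      simp only [h, one_smul, neg_smul] at h3 h4 ⊢
    · linear_combination (norm := module) h3 - h4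
    · linear_combination (norm := module) h3 + h4
termination_by p.length + q.length

theorem inner_shuffle (hc : ∀ x y, Commute (α x) (β y)) (c d : ListChain K) :
    inner (shuffle α β c d) = shuffle α β (inner c) d + shuffle α β (sgn c) (inner d) := by
  have : (shuffle α β).compr₂ inner =
      shuffle α β ∘ₗ inner + ((shuffle α β) ∘ₗ sgn).compl₂ inner :=
    hom_ext fun p => hom_ext fun q => by simp [inner_shuffleList hc]
  exact LinearMap.congr_fun₂ this c d

theorem tail_shuffle (c d : ListChain K) :
    tail (shuffle α β c d) = shuffle α β (tail c) d + shuffle α β (sgn c) (tail d) := by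
  have : (shuffle α β).compr₂ tail =
      shuffle α β ∘ₗ tail + ((shuffle α β) ∘ₗ sgn).compl₂ tail :=
    hom_ext fun p => hom_ext fun q => by simp [tail_shuffleList]
  exact LinearMap.congr_fun₂ this c d

theorem bd_shuffle (hc : ∀ x y, Commute (α x) (β y)) (c d : ListChain K) :
    bd (shuffle α β c d) = shuffle α β (bd c) d + shuffle α β (sgn c) (bd d) := by
  simp only [bd_apply, tail_shuffle, inner_shuffle hc, map_add, LinearMap.add_apply]
  abel

end Shuffle

end ListChain

namespace ListChain

variable {K A M : Type*} [AddCommGroup M] [Group K] [Group A]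

/-! ### Sums over the splittings of a list -/

/-- The sum of `F (x * g₁ ⋯ gₖ) [g₁, …, gₖ] [gₖ₊₁, …, gₘ]` over `0 ≤ k ≤ m`. -/
def splitSum : (K → List K → List K → M) → K → List K → M
  | F, x, [] => F x [] []
  | F, x, g :: l => F x [] (g :: l) + splitSum (fun y f r => F y (g :: f) r) (x * g) l

theorem splitSum_nil (F : K → List K → List K → M) (x : K) : splitSum F x [] = F x [] [] := rfl

theorem splitSum_cons (F : K → List K → List K → M) (x g : K) (l : List K) :
    splitSum F x (g :: l) =
      F x [] (g :: l) + splitSum (fun y f r => F y (g :: f) r) (x * g) l := rfl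

theorem splitSum_congr {F F' : K → List K → List K → M} (x : K) (l : List K)
    (h : ∀ y f r, f ++ r = l → F y f r = F' y f r) : splitSum F x l = splitSum F' x l := by
  induction l generalizing F F' x with
  | nil => exact h _ _ _ rfl
  | cons g l ih =>
    rw [splitSum_cons, splitSum_cons, h _ [] _ rfl, ih]
    intro y f r hfr
    exact h _ _ _ (by simp [hfr])

theorem splitSum_add (F F' : K → List K → List K → M) (x : K) (l : List K) :
    splitSum (fun y f r => F y f r + F' y f r) x l = splitSum F x l + splitSum F' x l := by
  induction l generalizing F F' x with
  | nil => rfl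
  | cons g l ih => simp only [splitSum_cons, ih]; abel

theorem map_splitSum {N : Type*} [AddCommGroup N] (φ : M →+ N)
    (F : K → List K → List K → M) (x : K) (l : List K) :
    φ (splitSum F x l) = splitSum (fun y f r => φ (F y f r)) x l := by
  induction l generalizing F x with
  | nil => rfl
  | cons g l ih => simp only [splitSum_cons, ih, map_add]

theorem splitSum_neg (F : K → List K → List K → M) (x : K) (l : List K) :
    splitSum (fun y f r => - F y f r) x l = - splitSum F x l :=
  (map_splitSum (-AddMonoidHom.id M) F x l).symm

theorem splitSum_mul (F : K → List K → List K → M) (z x : K) (l : List K) :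
    splitSum F (z * x) l = splitSum (fun y => F (z * y)) x l := by
  induction l generalizing F x with
  | nil => rfl
  | cons g l ih => simp only [splitSum_cons, mul_assoc, ih]

/-- Absorbing `g` into the first entry or into the base point gives the same running products; only
the terms with empty front differ. -/
theorem splitSum_mulHeadList (F : K → List K → List K → M) (x g : K) (l : List K) :
    splitSum F x (mulHeadList g l) + F (x * g) [] l =
      F x [] (mulHeadList g l) +
        splitSum (fun y f r => F y (mulHeadList g f) r) (x * g) l := by
  cases l with
  | nil => simp [splitSum_nil]
  | cons h l =>
    simp only [mulHeadList_cons, splitSum_cons, mulHeadList_nil, mul_assoc]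
    abel

theorem splitSum_map (F : List A → List A → M) (f : K →* A) (x : K) (y : A) (l : List K) :
    splitSum (fun _ => F) y (l.map f) = splitSum (fun _ p q => F (p.map f) (q.map f)) x l := by
  induction l generalizing F x y with
  | nil => rfl
  | cons g l ih =>
    simp only [List.map_cons, splitSum_cons, List.map_nil]
    rw [ih (fun p q => F (f g :: p) q) (x * g)]

theorem splitSum_ite_nil (F : List K → List K → M) (x : K) (l : List K) :
    splitSum (fun _ f r => if r = [] then 0 else F f r) x l + F l [] =
      splitSum (fun _ => F) x l := by
  induction l generalizing F x with
  | nil => simp [splitSum_nil]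
  | cons g l ih =>
    simp only [splitSum_cons, reduceCtorEq, if_false, ← ih (fun f r => F (g :: f) r)]
    abel

/-- The contribution to the coproduct formula of the face that moves the first entry of the second
part of a splitting to the first part. -/
def shiftTerm (F : K → List K → List K → M) (y : K) (f : List K) : List K → M
  | [] => 0
  | h :: r => F (y * h) f r

/-- The Alexander–Whitney cancellation: the last face of a front drops the entry before the cut, and
the shift term of the preceding cut is the same term with the opposite sign. Inner faces within a
front do not change its product `y`. -/
theorem lin_splitSum_inner (F : K → List K → List K → M) (x : K) (l : List K) :
    lin (splitSum F x) (inner (of l)) =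
      splitSum (fun y f r => lin (fun f' => F y f' r) (inner (of f)) +
        (-1 : ℤ) ^ f.length • (lin (F y f) (inner (of r)) + shiftTerm F y f r)) x l := by
  induction l generalizing F x with
  | nil => simp [splitSum_nil, shiftTerm]
  | cons g l ih =>
    have h1 : lin (splitSum F x) (cons g (inner (of l))) =
        lin (fun r => F x [] (g :: r)) (inner (of l)) +
          lin (splitSum (fun y f r => F y (g :: f) r) (x * g)) (inner (of l)) := by
      rw [lin_cons, ← lin_add]; rfl
    have h2 : ∀ y f r, lin (fun f' => F y f' r) (inner (of (g :: f))) +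
        (-1 : ℤ) ^ (g :: f).length • (lin (F y (g :: f)) (inner (of r)) +
          shiftTerm F y (g :: f) r) =
        - F y (mulHeadList g f) r + - (lin (fun f' => F y (g :: f') r) (inner (of f)) +
          (-1 : ℤ) ^ f.length • (lin (F y (g :: f)) (inner (of r)) +
            shiftTerm (fun y f r => F y (g :: f) r) y f r)) := by
      intro y f r
      have : shiftTerm F y (g :: f) r = shiftTerm (fun y f r => F y (g :: f) r) y f r := by
        cases r <;> rfl
      rw [this]
      simp only [inner_of_cons, map_sub, map_neg, lin_of, lin_cons, List.length_cons, pow_succ]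
      module
    rw [splitSum_cons]
    simp only [h2]
    rw [splitSum_add, splitSum_neg, splitSum_neg, ← ih]
    simp only [inner_of_cons, map_sub, map_neg, h1, lin_of, inner_of_nil, map_zero,
      List.length_nil, pow_zero, one_smul, lin_cons, shiftTerm, zero_add]
    have h3 := splitSum_mulHeadList F x g l
    linear_combination (norm := module) -h3

/-- The splitting is a chain map: when `F` ignores the running product, the shift term is the face
`d₀` of the back and completes its boundary. -/
theorem lin_splitSum_bd (F : List K → List K → M) (x : K) (l : List K) :
    lin (splitSum (fun _ => F) x) (bd (of l)) =
      splitSum (fun _ f r => lin (fun f' => F f' r) (bd (of f)) +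
        (-1 : ℤ) ^ f.length • lin (F f) (bd (of r))) x l := by
  have h1 : ∀ (y : K) (f r : List K), lin (fun f' => F f' r) (bd (of f)) +
        (-1 : ℤ) ^ f.length • lin (F f) (bd (of r)) =
      lin (fun f' => F f' r) (tail (of f)) + (lin (fun f' => F f' r) (inner (of f)) +
        (-1 : ℤ) ^ f.length • (lin (F f) (inner (of r)) + shiftTerm (fun _ => F) y f r)) := by
    intro y f r
    have : shiftTerm (fun _ => F) y f r = lin (F f) (tail (of r)) := by
      cases r <;> simp [shiftTerm]
    rw [this]
    simp only [bd_apply, map_add]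
    module
  have h2 : lin (splitSum (fun _ => F) x) (tail (of l)) =
      splitSum (fun _ f r => lin (fun f' => F f' r) (tail (of f))) x l := by
    cases l with
    | nil => simp [splitSum_nil]
    | cons g l =>
      -- The base point is irrelevant here; writing `x * g` as `(x * g * x⁻¹) * x` lets it be moved
      -- back to `x`.
      have := splitSum_mul (fun _ : K => F) (x * g * x⁻¹) x l
      simp only [inv_mul_cancel_right] at this
      simp [splitSum_cons, this]
  rw [splitSum_congr x l fun y f r _ => h1 y f r, splitSum_add, ← lin_splitSum_inner, ← h2,
    bd_apply, map_add]

/-! ### The prism of a conjugation -/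

section Conj

variable (β γ : K →* A) (s : A)

/-- The prism of the conjugation by `s`. -/
noncomputable def prismList : List K → ListChain A
  | [] => of [s]
  | g :: l => of (s :: (g :: l).map β) - cons (γ g) (prismList l)

/-- The chain homotopy given by the prism of the conjugation by `s`. -/
noncomputable def prism : ListChain K →ₗ[ℤ] ListChain A := lin (prismList β γ s)

@[simp] theorem prism_of_nil : prism β γ s (of []) = of [s] := lin_of _ _

@[simp] theorem prism_of_cons (g : K) (l : List K) :
    prism β γ s (of (g :: l)) =
      of (s :: β g :: l.map β) - cons (γ g) (prism β γ s (of l)) := by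
  simp [prism, prismList]

theorem prism_cons (g : K) (c : ListChain K) :
    prism β γ s (cons g c) =
      cons s (cons (β g) (map β c)) - cons (γ g) (prism β γ s c) := by
  have : prism β γ s ∘ₗ cons g =
      cons s ∘ₗ cons (β g) ∘ₗ map β - cons (γ g) ∘ₗ prism β γ s := hom_ext fun l => by simp
  exact LinearMap.congr_fun this c

theorem tail_prism (l : List K) :
    tail (prism β γ s (of l)) + prism β γ s (tail (of l)) = of (l.map β) := by
  cases l <;> simp

variable {β γ s}

/-- In consecutive prism terms, `s` is multiplied into `β g` and `γ g` into `s`; these faces cancel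
by `hs`. What survives is the last face of the term ending in `s`. -/
theorem inner_prism (hs : ∀ x, s * β x = γ x * s) (l : List K) :
    inner (prism β γ s (of l)) + prism β γ s (inner (of l)) = - of (l.map γ) := by
  induction l with
  | nil => simp
  | cons g l ih =>
    have h1 : mulHead (γ g) (prism β γ s (of l)) - prism β γ s (of (mulHeadList g l)) =
        of ((s * β g) :: l.map β) - of (s :: mulHeadList (β g) (l.map β)) := by
      cases l <;> simp [hs]
    have h2 := congrArg (cons (γ g)) ih
    simp only [map_add, map_neg, cons_of] at h2
    simp only [prism_of_cons, inner_of_cons, map_sub, map_neg, inner_cons, map_inner, map_of,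
      prism_cons, List.map_cons, mulHeadList_cons, cons_of]
    linear_combination (norm := module) h1 + h2

theorem bd_prism (hs : ∀ x, s * β x = γ x * s) (l : List K) :
    bd (prism β γ s (of l)) + prism β γ s (bd (of l)) = of (l.map β) - of (l.map γ) := by
  have h1 := inner_prism hs l
  have h2 := tail_prism β γ s l
  simp only [bd_apply, map_add]
  linear_combination (norm := module) h1 + h2

end Conj

/-! ### The Eilenberg–Zilber homotopy on the diagonal -/

section EilenbergZilber

variable (α β : K →* A)

/-- The sum of the shuffles `[β (g₁ ⋯ gₖ)] · (α [g₁, …, gₖ] ⧢ β [gₖ₊₁, …, gₘ])` for `k ≥ 1`. -/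
noncomputable def leadList : List K → ListChain A
  | [] => 0
  | g :: l => splitSum (fun y f r => cons (β y) (shuffleList α β (g :: f) r)) g l

/-- The Eilenberg–Zilber homotopy from the diagonal to the shuffle product of its
Alexander–Whitney diagonal approximation. -/
noncomputable def ezList : List K → ListChain A
  | [] => 0
  | g :: l => leadList α β (g :: l) - cons (α g * β g) (ezList l)

noncomputable def ez : ListChain K →ₗ[ℤ] ListChain A := lin (ezList α β)

/-- The terms of `leadList` together with the term for `k = 0`. -/
noncomputable def fullLeadList : List K → ListChain A :=
  splitSum (fun y f r => cons (β y) (shuffleList α β f r)) 1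

/-- The term with `k = 0` is added so that the splitting formula applies to all cuts at once; it is
subtracted again in `inner_ez`. -/
theorem fullLeadList_eq (l : List K) :
    fullLeadList α β l = leadList α β l + of (1 :: l.map β) := by
  cases l with
  | nil => simp [fullLeadList, leadList, splitSum_nil]
  | cons g l => simp [fullLeadList, leadList, splitSum_cons, add_comm]

/-- The shuffle product of the Alexander–Whitney diagonal approximation. -/
noncomputable def awList : List K → ListChain A :=
  splitSum (fun _ f r => shuffleList α β f r) 1

theorem tail_fullLeadList (l : List K) : tail (fullLeadList α β l) = awList α β l := by
  have := map_splitSum (tail : ListChain A →ₗ[ℤ] _).toAddMonoidHom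
    (fun y f r => cons (β y) (shuffleList α β f r)) 1 l
  simpa [fullLeadList, awList] using this

theorem tail_leadList (l : List K) :
    tail (leadList α β l) = awList α β l - of (l.map β) := by
  have h := congrArg tail (fullLeadList_eq α β l)
  rw [tail_fullLeadList, map_add, tail_of_cons] at h
  rw [h]; simp

/-- The part of `β y * (α f ⧢ β r)` whose first entry comes from `f`. -/
noncomputable def headTerm (y : K) : List K → List K → ListChain A
  | [], _ => 0
  | x :: f, r => cons (α x * β y) (shuffleList α β f r)

variable {α β}

/-- The first entry of a shuffle comes from `f` or from `r`. If it comes from `r`, multiplying it by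
`β y` extends the running product, which is the shift term. -/
theorem mulHead_shuffleList (hc : ∀ x y, Commute (α x) (β y)) (y : K) (f r : List K)
    (h : f ++ r ≠ []) :
    mulHead (β y) (shuffleList α β f r) =
      headTerm α β y f r +
      (-1 : ℤ) ^ f.length • shiftTerm (fun y f r => cons (β y) (shuffleList α β f r)) y f r := by
  match f, r with
  | [], [] => simp at h
  | [], z :: r => simp [headTerm, shiftTerm]
  | x :: f, [] => simp [headTerm, shiftTerm, (hc x y).eq]
  | x :: f, z :: r => simp [headTerm, shiftTerm, (hc x y).eq, shuffleList_cons_cons]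

/-- The Leibniz terms and shift terms cancel cut by cut, leaving the head terms. These need a
nonempty front, hence begin with `g` and run over the cuts of `l`. -/
theorem inner_fullLeadList (hc : ∀ x y, Commute (α x) (β y)) (g : K) (l : List K) :
    inner (fullLeadList α β (g :: l)) + lin (fullLeadList α β) (inner (of (g :: l))) =
      - mulHead (α g * β g) (fullLeadList α β l) := by
  have h1 := map_splitSum (inner : ListChain A →ₗ[ℤ] _).toAddMonoidHom
    (fun y f r => cons (β y) (shuffleList α β f r)) 1 (g :: l)
  simp only [LinearMap.toAddMonoidHom_coe] at h1
  rw [fullLeadList, lin_splitSum_inner, h1, ← splitSum_add]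
  have h2 : ∀ (y : K) (f r : List K), f ++ r = g :: l →
      inner (cons (β y) (shuffleList α β f r)) +
        (lin (fun f' => cons (β y) (shuffleList α β f' r)) (inner (of f)) +
          (-1 : ℤ) ^ f.length • (lin (fun r => cons (β y) (shuffleList α β f r)) (inner (of r)) +
            shiftTerm (fun y f r => cons (β y) (shuffleList α β f r)) y f r)) =
      - headTerm α β y f r := by
    intro y f r hfr
    have h3 : lin (fun f' => cons (β y) (shuffleList α β f' r)) (inner (of f)) =
        cons (β y) (shuffle α β (inner (of f)) (of r)) := by
      have : lin (fun f' => cons (β y) (shuffleList α β f' r)) =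
        cons (β y) ∘ₗ (shuffle α β).flip (of r) := hom_ext fun l => by simp
      simp [this]
    have h4 : lin (fun r => cons (β y) (shuffleList α β f r)) (inner (of r)) =
        cons (β y) (shuffle α β (of f) (inner (of r))) := by
      have : lin (fun r => cons (β y) (shuffleList α β f r)) =
        cons (β y) ∘ₗ (shuffle α β) (of f) := hom_ext fun l => by simp
      simp [this]
    rw [inner_cons, mulHead_shuffleList hc y f r (by simp [hfr]), h3, h4,
      inner_shuffleList hc]
    simp only [map_add, map_smul]
    module
  rw [splitSum_congr _ _ h2, splitSum_neg, splitSum_cons, headTerm, zero_add, one_mul]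
  simp only [headTerm]
  have h5 := splitSum_mul (fun y f r => cons (α g * β y) (shuffleList α β f r)) g 1 l
  rw [mul_one] at h5
  have h6 := map_splitSum (mulHead (α g * β g)).toAddMonoidHom
    (fun y f r => cons (β y) (shuffleList α β f r)) 1 l
  simp only [LinearMap.toAddMonoidHom_coe, mulHead_cons] at h6
  rw [h5, h6]
  simp [mul_assoc]

theorem ez_of (l : List K) : ez α β (of l) = ezList α β l := lin_of _ _

theorem ez_cons (g : K) (c : ListChain K) :
    ez α β (cons g c) = lin (leadList α β) (cons g c) - cons (α g * β g) (ez α β c) := by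
  have : ez α β ∘ₗ cons g = lin (leadList α β) ∘ₗ cons g - cons (α g * β g) ∘ₗ ez α β :=
    hom_ext fun l => by simp [ez_of, ezList]
  exact LinearMap.congr_fun this c

theorem tail_ez (l : List K) :
    tail (ez α β (of l)) + ez α β (tail (of l)) = awList α β l - of (l.map β) := by
  cases l with
  | nil => simp [ez_of, ezList, awList, splitSum_nil]
  | cons g l => simp [ez_of, ezList, tail_leadList]

theorem inner_ez (hc : ∀ x y, Commute (α x) (β y)) (l : List K) :
    inner (ez α β (of l)) + ez α β (inner (of l)) =
      of (l.map β) - of (l.map fun x => α x * β x) := by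
  induction l with
  | nil => simp [ez_of, ezList]
  | cons g l ih =>
    have h0 : fullLeadList α β = fun l => leadList α β l + of (1 :: l.map β) :=
      funext (fullLeadList_eq α β)
    have h1 := inner_fullLeadList hc g l
    have h2 : lin (fullLeadList α β) (inner (of (g :: l))) =
        lin (leadList α β) (inner (of (g :: l))) + cons 1 (inner (of ((g :: l).map β))) := by
      have : lin (fullLeadList α β) = lin (leadList α β) + cons 1 ∘ₗ map β :=
        hom_ext fun l => by simp [h0]
      rw [this, LinearMap.add_apply, LinearMap.comp_apply, map_inner, map_of]
    have h3 : mulHead (α g * β g) (ez α β (of l)) - ez α β (of (mulHeadList g l)) +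
        lin (leadList α β) (of (mulHeadList g l)) =
        mulHead (α g * β g) (leadList α β l) := by
      cases l with
      | nil => simp [ez_of, ezList, leadList]
      | cons h l =>
        -- Commutation makes the pointwise product `α · β` multiplicative.
        have : α g * (β g * (α h * β h)) = α g * (α h * (β g * β h)) := by
          rw [← mul_assoc (β g), ← (hc h g).eq, mul_assoc]
        simp [ez_of, ezList, mul_assoc, this]
    have h4 := congrArg (cons (α g * β g)) ih
    rw [h2, h0] at h1
    simp only [map_add, map_sub, map_neg, cons_of, inner_of_cons, mulHead_of, mulHeadList_cons,
      mul_one, one_mul, List.map_cons, lin_of] at h1 h3 h4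
    rw [ez_of]
    simp only [ezList, map_sub, map_neg, inner_of_cons, inner_cons, ez_cons, ← ez_of,
      List.map_cons] at h1 ⊢
    linear_combination (norm := module) h1 + h3 + h4

theorem bd_ez (hc : ∀ x y, Commute (α x) (β y)) (l : List K) :
    bd (ez α β (of l)) + ez α β (bd (of l)) =
      awList α β l - of (l.map fun x => α x * β x) := by
  have h1 := inner_ez hc l
  have h2 := tail_ez (α := α) (β := β) l
  simp only [bd_apply, map_add]
  linear_combination (norm := module) h1 + h2

end EilenbergZilber

/-! ### The inductive step -/

section Step

variable {G : Type*} [Group G] (α β : K →* A) (j : G →* K)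

/-- The shuffles of the values of `Θ` on the front faces with the back faces of positive
dimension. -/
noncomputable def frontShuffleList (Θ : ListChain G →ₗ[ℤ] ListChain K) :
    List G → ListChain A :=
  splitSum (fun _ f r => shuffle α β (Θ (of f)) (map j (positive (of r)))) 1

variable {α β j}

/-- At each cut the boundary acts on the front through `bd Θ + Θ bd = j`, and the terms with a
boundary of the back cancel because `Θ` raises degree by one. Cuts with empty front or back
contribute nothing, which accounts for the two subtracted terms. -/
theorem bd_frontShuffleList (hc : ∀ x y, Commute (α x) (β y))
    {Θ : ListChain G →ₗ[ℤ] ListChain K} (n : ℕ) (h0 : Θ (of []) = 0)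
    (hΘ : ∀ l, l ≠ [] → l.length ≤ n → bd (Θ (of l)) + Θ (bd (of l)) = of (l.map j))
    (hs : ∀ l, l.length ≤ n → sgn (Θ (of l)) = (-1 : ℤ) ^ (l.length + 1) • Θ (of l))
    (l : List G) (hl : l ≠ []) (hn : l.length ≤ n + 1) :
    bd (frontShuffleList α β j Θ l) + lin (frontShuffleList α β j Θ) (bd (of l)) =
      awList α β (l.map j) - of (l.map (α.comp j)) - of (l.map (β.comp j)) := by
  have h1 := map_splitSum (bd : ListChain A →ₗ[ℤ] _).toAddMonoidHom
    (fun _ f r => shuffle α β (Θ (of f)) (map j (positive (of r)))) 1 l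
  simp only [LinearMap.toAddMonoidHom_coe] at h1
  have h2 : ∀ (y : G) (f r : List G), f ++ r = l →
      bd (shuffle α β (Θ (of f)) (map j (positive (of r)))) +
        (lin (fun f' => shuffle α β (Θ (of f')) (map j (positive (of r)))) (bd (of f)) +
          (-1 : ℤ) ^ f.length •
            lin (fun r' => shuffle α β (Θ (of f)) (map j (positive (of r')))) (bd (of r))) =
      if f = [] then 0 else if r = [] then 0 else shuffleList α β (f.map j) (r.map j) := by
    intro y f r hfr
    have h3 : lin (fun f' => shuffle α β (Θ (of f')) (map j (positive (of r)))) (bd (of f)) =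
        shuffle α β (Θ (bd (of f))) (map j (positive (of r))) := by
      have : lin (fun f' => shuffle α β (Θ (of f')) (map j (positive (of r)))) =
          (shuffle α β).flip (map j (positive (of r))) ∘ₗ Θ := hom_ext fun l => by simp
      simp [this]
    have h4 : lin (fun r' => shuffle α β (Θ (of f)) (map j (positive (of r')))) (bd (of r)) =
        shuffle α β (Θ (of f)) (bd (map j (positive (of r)))) := by
      have : lin (fun r' => shuffle α β (Θ (of f)) (map j (positive (of r')))) =
          shuffle α β (Θ (of f)) ∘ₗ map j ∘ₗ positive := hom_ext fun l => by simp
      rw [this, map_positive, bd_positive, LinearMap.comp_apply, LinearMap.comp_apply,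
        positive_bd, map_bd]
    have h7 : shuffle α β (sgn (Θ (of f))) (bd (map j (positive (of r)))) =
        (-1 : ℤ) ^ (f.length + 1) • shuffle α β (Θ (of f)) (bd (map j (positive (of r)))) := by
      -- A front of full length may exceed the range `n` of the hypotheses on `Θ`, but then the back
      -- is empty and contributes zero.
      by_cases hr : r = []
      · simp [hr]
      · have hr' : 0 < r.length := List.length_pos_iff.mpr hr
        have := congrArg List.length hfr
        rw [List.length_append] at this
        rw [hs f (by omega), map_smul, LinearMap.smul_apply]
    rw [h3, h4, bd_shuffle hc, h7]
    have h5 : shuffle α β (bd (Θ (of f))) (map j (positive (of r))) +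
        shuffle α β (Θ (bd (of f))) (map j (positive (of r))) =
        if f = [] then 0 else if r = [] then 0 else shuffleList α β (f.map j) (r.map j) := by
      rw [← LinearMap.add_apply, ← map_add]
      split_ifs with hf hr
      · subst hf; simp [h0, bd_apply]
      · subst hr; simp
      · have hr' : 0 < r.length := List.length_pos_iff.mpr hr
        have := congrArg List.length hfr
        rw [List.length_append] at this
        rw [hΘ f hf (by omega)]
        obtain ⟨z, r, rfl⟩ := List.exists_cons_of_ne_nil hr
        simp
    rw [← h5]
    simp only [pow_succ]
    module
  obtain ⟨g, l, rfl⟩ := List.exists_cons_of_ne_nil hl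
  have h6 := splitSum_ite_nil (fun f r => shuffleList α β ((g :: f).map j) (r.map j)) g l
  have h7 := splitSum_map (fun f r => shuffleList α β (j g :: f) r) j g (j g) l
  rw [frontShuffleList, h1, lin_splitSum_bd, ← splitSum_add, splitSum_congr _ _ h2]
  simp only [splitSum_cons, one_mul, if_true, reduceCtorEq, if_false, zero_add, awList,
    List.map_cons, h7] at h6 ⊢
  rw [← h6]
  simp
  abel

/-- The value of the homotopy for the mitosis in terms of the homotopy `Θ` of the preceding
stage. -/
noncomputable def stepHomotopy (α β : K →* A) (γ : K →* A) (s : A) (j : G →* K)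
    (Θ : ListChain G →ₗ[ℤ] ListChain K) : ListChain G →ₗ[ℤ] ListChain A :=
  ez α β ∘ₗ map j - prism β γ s ∘ₗ map j ∘ₗ positive - lin (frontShuffleList α β j Θ)

/-- With `j` suppressed, the three boundary formulas telescope: `(aw - γ) - (β - γ) - (aw - α - β) =
α`. -/
theorem bd_stepHomotopy (hc : ∀ x y, Commute (α x) (β y)) {γ : K →* A} {s : A}
    (hγ : ∀ x, γ x = α x * β x) (hsβ : ∀ x, s * β x = γ x * s)
    {Θ : ListChain G →ₗ[ℤ] ListChain K} (n : ℕ) (h0 : Θ (of []) = 0)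
    (hΘ : ∀ l, l ≠ [] → l.length ≤ n → bd (Θ (of l)) + Θ (bd (of l)) = of (l.map j))
    (hs : ∀ l, l.length ≤ n → sgn (Θ (of l)) = (-1 : ℤ) ^ (l.length + 1) • Θ (of l))
    (l : List G) (hl : l ≠ []) (hn : l.length ≤ n + 1) :
    bd (stepHomotopy α β γ s j Θ (of l)) + stepHomotopy α β γ s j Θ (bd (of l)) =
      of (l.map (α.comp j)) := by
  have h1 := bd_frontShuffleList hc n h0 hΘ hs l hl hn
  have h2 := bd_ez hc (l.map j)
  have h3 := bd_prism hsβ (l.map j)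
  have h4 : positive (of l) = of l := by
    obtain ⟨g, l, rfl⟩ := List.exists_cons_of_ne_nil hl
    simp
  have h5 : (fun x => α x * β x) = γ := funext fun x => (hγ x).symm
  simp only [h5, List.map_map] at h2 h3
  simp only [stepHomotopy, LinearMap.sub_apply, LinearMap.comp_apply, h4,
    positive_bd, map_bd, map_of, lin_of, map_sub]
  simp only [MonoidHom.coe_comp] at h1 ⊢
  linear_combination (norm := module) h2 - h1 - h3

theorem stepHomotopy_nil {γ : K →* A} {s : A} {Θ : ListChain G →ₗ[ℤ] ListChain K} :
    stepHomotopy α β γ s j Θ (of []) = 0 := by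
  simp [stepHomotopy, ez_of, ezList, frontShuffleList, splitSum_nil]

end Step

end ListChain

/-! ### Signed sums of basis elements -/

/-- The chain `c` is a sum of `N` basis elements with signs, all of which satisfy `P`. -/
inductive SignedSum {X : Type*} (P : X → Prop) : ℕ → (X →₀ ℤ) → Prop
  | zero : SignedSum P 0 0
  | pos {x : X} {N : ℕ} {c : X →₀ ℤ} :
      P x → SignedSum P N c → SignedSum P (N + 1) (c + Finsupp.single x 1)
  | neg {x : X} {N : ℕ} {c : X →₀ ℤ} :
      P x → SignedSum P N c → SignedSum P (N + 1) (c - Finsupp.single x 1)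

namespace SignedSum

variable {X Y : Type*} {P : X → Prop} {Q : Y → Prop} {N N' : ℕ} {c c' : X →₀ ℤ}

theorem single {x : X} (h : P x) : SignedSum P 1 (Finsupp.single x 1) := by
  simpa using pos h zero

protected theorem add (h : SignedSum P N c) (h' : SignedSum P N' c') :
    SignedSum P (N + N') (c + c') := by
  induction h' with
  | zero => simpa using h
  | pos hx _ ih => rw [← add_assoc, ← add_assoc]; exact pos hx ih
  | neg hx _ ih => rw [← add_assoc, ← add_sub_assoc]; exact neg hx ih

protected theorem opp (h : SignedSum P N c) : SignedSum P N (-c) := by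
  induction h with
  | zero => simpa using zero
  | pos hx _ ih => rw [neg_add, ← sub_eq_add_neg]; exact neg hx ih
  | neg hx _ ih => rw [neg_sub', sub_neg_eq_add]; exact pos hx ih

protected theorem sub (h : SignedSum P N c) (h' : SignedSum P N' c') :
    SignedSum P (N + N') (c - c') := by
  rw [sub_eq_add_neg]; exact h.add h'.opp

theorem sign_smul (h : SignedSum P N c) (k : ℕ) : SignedSum P N ((-1 : ℤ) ^ k • c) := by
  rcases neg_one_pow_eq_or ℤ k with hk | hk <;> rw [hk]
  · simpa using h
  · simpa using h.opp

theorem bind (h : SignedSum P N c) (φ : (X →₀ ℤ) →ₗ[ℤ] (Y →₀ ℤ))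
    (hφ : ∀ x, P x → SignedSum Q N' (φ (Finsupp.single x 1))) :
    SignedSum Q (N * N') (φ c) := by
  induction h with
  | zero => simpa using zero
  | pos hx _ ih => rw [map_add, add_mul, one_mul]; exact ih.add (hφ _ hx)
  | neg hx _ ih => rw [map_sub, add_mul, one_mul]; exact ih.sub (hφ _ hx)

theorem mono {P' : X → Prop} (h : SignedSum P N c) (hP : ∀ x, P x → P' x) :
    SignedSum P' N c := by
  induction h with
  | zero => exact zero
  | pos hx _ ih => exact pos (hP _ hx) ih
  | neg hx _ ih => exact neg (hP _ hx) ih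

theorem apply_eq_zero (h : SignedSum P N c) {x : X} (hx : ¬ P x) : c x = 0 := by
  induction h with
  | zero => rfl
  | @pos y _ _ hy _ ih =>
    have : y ≠ x := fun e => hx (e ▸ hy)
    simp [ih, this]
  | @neg y _ _ hy _ ih =>
    have : y ≠ x := fun e => hx (e ▸ hy)
    simp [ih, this]

theorem eq_of_forall {f g : (X →₀ ℤ) →ₗ[ℤ] (Y →₀ ℤ)} (h : SignedSum P N c)
    (hfg : ∀ x, P x → f (Finsupp.single x 1) = g (Finsupp.single x 1)) : f c = g c := by
  induction h with
  | zero => simp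
  | pos hx _ ih => simp [ih, hfg _ hx]
  | neg hx _ ih => simp [ih, hfg _ hx]

end SignedSum

/-! ### Counting the terms of the homotopies -/

namespace ListChain

variable {K A G : Type*}

/-- Lists of length `m` with entries in `E`. -/
def Entries (E : A → Prop) (m : ℕ) (l : List A) : Prop := l.length = m ∧ ∀ a ∈ l, E a

theorem signedSum_of {P : List A → Prop} {l : List A} (h : P l) : SignedSum P 1 (of l) :=
  .single h

theorem signedSum_cons {E : A → Prop} {a : A} (ha : E a) {m N : ℕ} {c : ListChain A}
    (h : SignedSum (Entries E m) N c) : SignedSum (Entries E (m + 1)) N (cons a c) := by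
  have := h.bind (Q := Entries E (m + 1)) (N' := 1) (cons a) fun l hl => by
    have h1 : cons a (Finsupp.single l 1) = Finsupp.single (a :: l) 1 := cons_of a l
    rw [h1]
    exact .single ⟨by simp [hl.1], by simpa using ⟨ha, hl.2⟩⟩
  simpa using this

/-- Supplies the homogeneity of `Θ` that fixes the sign in `bd_frontShuffleList`. -/
theorem sgn_of_signedSum {m N : ℕ} {c : ListChain K}
    (h : SignedSum (fun l => l.length = m) N c) : sgn c = (-1 : ℤ) ^ m • c :=
  h.eq_of_forall (f := sgn) (g := (-1 : ℤ) ^ m • (LinearMap.id : ListChain K →ₗ[ℤ] _))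
    fun l hl => by
      subst hl
      exact sgn_of l

variable [Group K] [Group A] [Group G]

theorem signedSum_splitSum {X : Type*} {P : X → Prop} {F : K → List K → List K → X →₀ ℤ}
    {N : ℕ → ℕ → ℕ} (x : K) (l : List K)
    (h : ∀ y f r, f.length + r.length = l.length →
      SignedSum P (N f.length r.length) (F y f r)) :
    SignedSum P (∑ k ∈ Finset.range (l.length + 1), N k (l.length - k)) (splitSum F x l) := by
  induction l generalizing F x N with
  | nil => simpa [splitSum_nil] using h x [] [] rfl
  | cons g l ih =>
    rw [splitSum_cons, Finset.sum_range_succ', add_comm]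
    refine (h x [] (g :: l) (by simp)).add ?_
    have := ih (F := fun y f r => F y (g :: f) r) (N := fun k i => N (k + 1) i) (x * g)
      fun y f r hfr => h y (g :: f) r (by simp; omega)
    simpa using this

section

variable {E : A → Prop} {α β γ : K →* A} {s : A}

theorem entries_map (hβ : ∀ x, E (β x)) (l : List K) : Entries E l.length (l.map β) :=
  ⟨by simp, fun a ha => by obtain ⟨x, -, rfl⟩ := List.mem_map.mp ha; exact hβ x⟩

/-- The recursion on the first letter of a shuffle is Pascal's rule. -/
theorem signedSum_shuffleList (hα : ∀ x, E (α x)) (hβ : ∀ x, E (β x)) (p q : List K) :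
    SignedSum (Entries E (p.length + q.length)) (Nat.choose (p.length + q.length) p.length)
      (shuffleList α β p q) := by
  match p, q with
  | [], q =>
    rw [shuffleList_nil]; simpa using signedSum_of (entries_map hβ q)
  | x :: p, [] =>
    rw [shuffleList_nil_right]; simpa using signedSum_of (entries_map hα (x :: p))
  | x :: p, y :: q =>
    have h1 := signedSum_cons (hα x) (signedSum_shuffleList hα hβ p (y :: q))
    have h2 := (signedSum_cons (hβ y) (signedSum_shuffleList hα hβ (x :: p) q)).sign_smul (p.length + 1)
    rw [shuffleList_cons_cons]
    simp only [List.length_cons] at h1 h2 ⊢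
    have e1 : p.length + 1 + (q.length + 1) = p.length + (q.length + 1) + 1 := by omega
    have e2 : p.length + 1 + q.length = p.length + (q.length + 1) := by omega
    rw [e1, Nat.choose_succ_succ]
    rw [e2] at h2
    exact h1.add h2
termination_by p.length + q.length

theorem signedSum_prism (hβ : ∀ x, E (β x)) (hγ : ∀ x, E (γ x)) (hs : E s) (l : List K) :
    SignedSum (Entries E (l.length + 1)) (l.length + 1) (prism β γ s (of l)) := by
  induction l with
  | nil => rw [prism_of_nil]; exact .single ⟨rfl, by simpa using hs⟩
  | cons g l ih =>
    rw [prism_of_cons, List.length_cons, add_comm (l.length + 1) 1]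
    refine SignedSum.sub (.single ⟨by simp; omega, ?_⟩) ?_
    · simpa using ⟨hs, hβ g, fun x _ => hβ x⟩
    · rw [add_comm 1]; exact signedSum_cons (hγ g) ih

theorem signedSum_leadList (hα : ∀ x, E (α x)) (hβ : ∀ x, E (β x)) (g : K) (l : List K) :
    SignedSum (Entries E (l.length + 2)) (2 ^ (l.length + 1) - 1) (leadList α β (g :: l)) := by
  have := signedSum_splitSum (P := Entries E (l.length + 2))
    (F := fun y f r => cons (β y) (shuffleList α β (g :: f) r))
    (N := fun k i => Nat.choose (k + 1 + i) (k + 1)) g l fun y f r hfr => by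
      have := signedSum_cons (hβ y) (signedSum_shuffleList hα hβ (g :: f) r)
      have e : f.length + 1 + r.length = l.length + 1 := by omega
      simp only [List.length_cons, e] at this ⊢
      exact this
  rw [leadList]
  convert this using 1
  -- The row of binomial coefficients sums to a power of two; the missing cut with empty front
  -- accounts for the `- 1`.
  have h2 := Nat.sum_range_choose (l.length + 1)
  rw [Finset.sum_range_succ'] at h2
  simp only [Nat.choose_zero_right] at h2
  rw [← h2, Nat.add_sub_cancel]
  refine Finset.sum_congr rfl fun k hk => ?_
  have := Finset.mem_range.mp hk
  congr 1; omega

/-- `E` need not be closed under products: the entries `α g * β g` are covered because they are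
values of `γ`. -/
theorem signedSum_ez (hα : ∀ x, E (α x)) (hβ : ∀ x, E (β x)) (hγ : ∀ x, E (γ x)) (hm : ∀ x, γ x = α x * β x) (l : List K) :
    SignedSum (Entries E (l.length + 1)) (2 ^ (l.length + 1) - (l.length + 2))
      (ez α β (of l)) := by
  rw [ez_of]
  induction l with
  | nil => simpa [ezList] using SignedSum.zero
  | cons g l ih =>
    have h := (signedSum_leadList hα hβ g l).sub (signedSum_cons (hγ g) ih)
    rw [hm] at h
    have : ∀ m : ℕ, m + 1 < 2 ^ (m + 1) := fun m => Nat.lt_two_pow_self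
    have := this l.length
    rw [ezList, List.length_cons]
    convert h using 1
    rw [pow_succ 2 (l.length + 1)]
    omega

/-- Each of the `N k` terms of `Θ` on a front of length `k` has length `k + 1` and is shuffled with
the back. Nothing is needed about its entries, since they pass through `α`. -/
theorem signedSum_frontShuffleList (hα : ∀ x, E (α x)) (hβ : ∀ x, E (β x)) {j : G →* K} {Θ : ListChain G →ₗ[ℤ] ListChain K}
    {n : ℕ} {N : ℕ → ℕ}
    (hΘ : ∀ l, l.length ≤ n →
      SignedSum (fun l' => l'.length = l.length + 1) (N l.length) (Θ (of l)))
    (l : List G) (hl : l.length ≤ n + 1) :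
    SignedSum (Entries E (l.length + 1))
      (∑ k ∈ Finset.range l.length, N k * Nat.choose (l.length + 1) (k + 1))
      (frontShuffleList α β j Θ l) := by
  have := signedSum_splitSum (P := Entries E (l.length + 1))
    (F := fun _ f r => shuffle α β (Θ (of f)) (map j (positive (of r))))
    (N := fun k i => if i = 0 then 0 else N k * Nat.choose (k + 1 + i) (k + 1)) 1 l
    fun y f r hfr => by
      cases r with
      | nil => simpa using SignedSum.zero
      | cons z r =>
        have h1 := (hΘ f (by simp at hfr; omega)).bind (Q := Entries E (l.length + 1))
          (N' := Nat.choose (f.length + 1 + (r.length + 1)) (f.length + 1))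
          ((shuffle α β).flip (of ((z :: r).map j))) fun p hp => by
            have h2 := signedSum_shuffleList hα hβ p ((z :: r).map j)
            rw [← shuffle_of] at h2
            have e : f.length + 1 + (r.length + 1) = l.length + 1 := by simp at hfr; omega
            simpa [hp, e, of] using h2
        simpa using h1
  rw [Finset.sum_range_succ, Nat.sub_self, if_pos rfl, add_zero] at this
  rw [frontShuffleList]
  convert this using 1
  refine Finset.sum_congr rfl fun k hk => ?_
  have := Finset.mem_range.mp hk
  rw [if_neg (by omega)]
  congr 2; omega

end

end ListChain

/-! ### The counting functions -/

theorem gammaFn_succ (m : ℕ) : gammaFn (m + 1) = 2 ^ (m + 1) * (m + 2) +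
    ∑ k ∈ Finset.range m, gammaFn (k + 1) * Nat.choose (m + 2) (m - k) := by
  rw [gammaFn, Finset.sum_range]

theorem qFn_succ (m : ℕ) : qFn (m + 1) = 2 ^ (m + 1) * m + 1 +
    ∑ k ∈ Finset.range m, qFn (k + 1) * Nat.choose (m + 2) (m - k) := by
  rw [qFn, Finset.sum_range]

theorem gammaFn_zero : gammaFn 0 = 0 := by rw [gammaFn]
theorem qFn_zero : qFn 0 = 0 := by rw [qFn]

theorem sum_range_mul_choose (f : ℕ → ℕ) (hf : f 0 = 0) (m : ℕ) :
    ∑ k ∈ Finset.range m, f (k + 1) * Nat.choose (m + 2) (m - k) =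
      ∑ k ∈ Finset.range (m + 1), f k * Nat.choose (m + 2) (k + 1) := by
  rw [Finset.sum_range_succ' _ m, hf, zero_mul, add_zero]
  refine Finset.sum_congr rfl fun k hk => ?_
  have := Finset.mem_range.mp hk
  rw [← Nat.choose_symm (show k + 1 + 1 ≤ m + 2 by omega)]
  congr 2; omega

theorem sum_range_eq_sum_Icc (f : ℕ → ℕ) (m : ℕ) :
    ∑ k ∈ Finset.range m, f (k + 1) * Nat.choose (m + 2) (m - k) =
      ∑ k ∈ Finset.Icc 1 m, f k * Nat.choose (m + 2) (m + 1 - k) := by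
  rw [Finset.range_eq_Ico, ← Finset.Ico_add_one_right_eq_Icc,
    ← Finset.sum_Ico_add' _ 0 m 1]
  refine Finset.sum_congr rfl fun k _ => ?_
  congr 2; omega

/-- The difference of `gammaFn` and `qFn`. -/
def excessFn (m : ℕ) : ℕ := gammaFn m - qFn m

theorem qFn_le_gammaFn (m : ℕ) : qFn m ≤ gammaFn m := by
  induction m using Nat.strong_induction_on with
  | _ m ih =>
    cases m with
    | zero => simp [qFn_zero]
    | succ m =>
      rw [qFn_succ, gammaFn_succ]
      refine add_le_add ?_ (Finset.sum_le_sum fun k hk => Nat.mul_le_mul_right _ (ih _ ?_))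
      · have := Nat.one_le_two_pow (n := m + 1)
        nlinarith
      · have := Finset.mem_range.mp hk; omega

theorem excessFn_add_qFn (m : ℕ) : excessFn m + qFn m = gammaFn m :=
  Nat.sub_add_cancel (qFn_le_gammaFn m)

/-- Both recurrences have the same linear part, so only their leading terms are subtracted. The
result matches the term count of `stepHomotopy`. -/
theorem excessFn_succ (m : ℕ) : excessFn (m + 1) = 2 ^ (m + 2) - 1 +
    ∑ k ∈ Finset.range (m + 1), excessFn k * Nat.choose (m + 2) (k + 1) := by
  have h : ∑ k ∈ Finset.range (m + 1), excessFn k * Nat.choose (m + 2) (k + 1) +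
      ∑ k ∈ Finset.range (m + 1), qFn k * Nat.choose (m + 2) (k + 1) =
      ∑ k ∈ Finset.range (m + 1), gammaFn k * Nat.choose (m + 2) (k + 1) := by
    rw [← Finset.sum_add_distrib]
    exact Finset.sum_congr rfl fun k _ => by rw [← add_mul, excessFn_add_qFn]
  have h1 := excessFn_add_qFn (m + 1)
  rw [qFn_succ, gammaFn_succ, sum_range_mul_choose _ qFn_zero,
    sum_range_mul_choose _ gammaFn_zero] at h1
  have h2 := Nat.one_le_two_pow (n := m + 2)
  have h3 : 2 ^ (m + 1) * (m + 2) = 2 ^ (m + 1) * m + 2 ^ (m + 2) := by ring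
  omega

/-- The factor 4 is forced by the values 4 and 1 at `m = 1`, and the common linear recurrence
propagates it. -/
theorem gammaFn_le_four_mul_qFn (m : ℕ) : gammaFn m ≤ 4 * qFn m := by
  induction m using Nat.strong_induction_on with
  | _ m ih =>
    cases m with
    | zero => simp [gammaFn_zero]
    | succ m =>
      rw [qFn_succ, gammaFn_succ, mul_add 4, Finset.mul_sum]
      refine add_le_add ?_ (Finset.sum_le_sum fun k hk => ?_)
      · cases m with
        | zero => norm_num
        | succ m =>
          have := Nat.one_le_two_pow (n := m + 1 + 1)
          nlinarith
      · rw [← mul_assoc]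
        refine Nat.mul_le_mul_right _ (ih _ ?_)
        have := Finset.mem_range.mp hk; omega

theorem mul_le_qFn_succ (m : ℕ) : (m + 2) * qFn m ≤ qFn (m + 1) := by
  rw [qFn_succ, sum_range_mul_choose _ qFn_zero, Finset.sum_range_succ]
  -- Only the last summand of the recurrence is kept; this is its coefficient.
  have : Nat.choose (m + 2) (m + 1) = m + 2 := by simp
  rw [this]
  nlinarith [Nat.zero_le (∑ x ∈ Finset.range m, qFn x * (m + 2).choose (x + 1)),
    Nat.zero_le (2 ^ (m + 1) * m)]

theorem gammaFn_le_qFn_succ (m : ℕ) : gammaFn m ≤ qFn (m + 1) := by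
  match m with
  | 0 => simp [gammaFn_zero]
  | 1 => rw [gammaFn_succ, qFn_succ 1, Finset.sum_range_one, qFn_succ]; norm_num
  -- From here on the factor in `mul_le_qFn_succ` is at least 4.
  | m + 2 =>
    have h1 := gammaFn_le_four_mul_qFn (m + 2)
    have h2 := mul_le_qFn_succ (m + 2)
    nlinarith

theorem gammaFn_mono : Monotone gammaFn :=
  monotone_nat_of_le_succ fun m => (gammaFn_le_qFn_succ m).trans (qFn_le_gammaFn _)

/-- Modulo 2, `C(2i + 2, k + 1)` vanishes for even `k`, while `q(k)` is 1 for odd `k` by induction.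
So the sum becomes a full binomial row without its two ends, `2 ^ (2i + 2) - 2`, which is even. -/
theorem odd_qFn {m : ℕ} (hm : Odd m) : Odd (qFn m) := by
  induction m using Nat.strong_induction_on with
  | _ m ih =>
    obtain ⟨i, rfl⟩ := hm
    rw [qFn_succ, sum_range_mul_choose _ qFn_zero, ← ZMod.natCast_eq_one_iff_odd]
    have h1 : ∀ k ∈ Finset.range (2 * i + 1),
        ((qFn k * Nat.choose (2 * i + 2) (k + 1) : ℕ) : ZMod 2) =
          ((Nat.choose (2 * i + 2) (k + 1) : ℕ) : ZMod 2) := by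
      intro k hk
      rw [Nat.cast_mul]
      rcases Nat.even_or_odd k with hk' | hk'
      · have h2 := Nat.add_one_mul_choose_eq (2 * i + 1) k
        have h3 : ((Nat.choose (2 * i + 2) (k + 1) : ℕ) : ZMod 2) = 0 := by
          rw [ZMod.natCast_eq_zero_iff_even]
          have : Even ((2 * i + 1).succ.choose (k + 1) * (k + 1)) := by
            rw [← h2]; exact Even.mul_right ⟨i + 1, by omega⟩ _
          rcases Nat.even_mul.mp this with h | h
          · exact h
          · exact absurd h (by simpa using hk'.add_one)
        rw [h3, mul_zero]
      · rw [ZMod.natCast_eq_one_iff_odd.mpr (ih k (by simpa using hk) hk'), one_mul]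
    have h4 : ∑ k ∈ Finset.range (2 * i + 1), Nat.choose (2 * i + 2) (k + 1) + 2 =
        2 ^ (2 * i + 2) := by
      rw [← Nat.sum_range_choose, Finset.sum_range_succ _ (2 * i + 2),
        Finset.sum_range_succ' _ (2 * i + 1)]
      simp only [Nat.choose_self, Nat.choose_zero_right]
    have h5 := congrArg (Nat.cast (R := ZMod 2)) h4
    rw [Nat.cast_add, Nat.cast_add, Nat.cast_sum, Finset.sum_congr rfl h1, ← Nat.cast_sum]
    have h6 : ((2 : ℕ) : ZMod 2) = 0 := rfl
    rw [Nat.cast_add, Nat.cast_pow, h6, add_zero, zero_pow (by omega)] at h5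
    rw [h5, Nat.cast_mul, Nat.cast_pow, h6, zero_pow (by omega), zero_mul, zero_add,
      add_zero, Nat.cast_one]

/-! ### The mitosis -/

section Mitosis

variable (K : Type u) [Group K]

/-- The image of the generator `u` in the mitosis. -/
def mitosisGenU : Mitosis K := QuotientGroup.mk' _ (mitosisU K)

/-- The image of the generator `t` in the mitosis. -/
def mitosisGenT : Mitosis K := QuotientGroup.mk' _ (mitosisT K)

/-- The conjugate of the canonical homomorphism by an element. -/
def mitosisConj (y : Mitosis K) : K →* Mitosis K :=
  (MulAut.conj y).toMonoidHom.comp (mitosisHom K)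

theorem mitosisConj_apply (y : Mitosis K) (a : K) :
    mitosisConj K y a = y * mitosisHom K a * y⁻¹ := rfl

theorem mitosisConj_genT (a : K) :
    mitosisConj K (mitosisGenT K) a =
      mitosisHom K a * mitosisConj K (mitosisGenU K) a := by
  have h : conjBy (mitosisBase K a) (mitosisT K) *
      (mitosisBase K a * conjBy (mitosisBase K a) (mitosisU K))⁻¹ ∈
        Subgroup.normalClosure (mitosisRels K) :=
    Subgroup.subset_normalClosure (Or.inl ⟨a, rfl⟩)
  rw [← QuotientGroup.eq_one_iff] at h
  exact mul_inv_eq_one.mp h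

theorem commute_mitosisHom_mitosisConj (a b : K) :
    Commute (mitosisHom K a) (mitosisConj K (mitosisGenU K) b) := by
  have h : commOf (conjBy (mitosisBase K b) (mitosisU K)) (mitosisBase K a) ∈
        Subgroup.normalClosure (mitosisRels K) :=
    Subgroup.subset_normalClosure (Or.inr ⟨b, a, rfl⟩)
  rw [← QuotientGroup.eq_one_iff] at h
  exact (commutatorElement_eq_one_iff_commute.mp h).symm

/-- The exponent sum of `t`, before passing to the quotient. -/
def mitosisFreeDegree : MitosisFree K →* Multiplicative ℤ :=
  Monoid.Coprod.lift 1 (FreeGroup.lift fun b => if b then Multiplicative.ofAdd 1 else 1)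

/-- The exponent sum of `t`. -/
def mitosisDegree : Mitosis K →* Multiplicative ℤ :=
  QuotientGroup.lift _ (mitosisFreeDegree K) fun x hx => by
    have : Subgroup.normalClosure (mitosisRels K) ≤ (mitosisFreeDegree K).ker := by
      refine Subgroup.normalClosure_le_normal ?_
      rintro _ (⟨a, rfl⟩ | ⟨a, b, rfl⟩) <;>
        simp [MonoidHom.mem_ker, mitosisFreeDegree, conjBy, commOf, mitosisBase]
    exact this hx

theorem mitosisDegree_mitosisHom (a : K) : mitosisDegree K (mitosisHom K a) = 1 := by
  change mitosisFreeDegree K (mitosisBase K a) = 1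
  simp [mitosisFreeDegree, mitosisBase]

theorem mitosisDegree_mitosisConj (y : Mitosis K) (a : K) :
    mitosisDegree K (mitosisConj K y a) = 1 := by
  simp [mitosisConj_apply, mitosisDegree_mitosisHom]

theorem mitosisDegree_genU : mitosisDegree K (mitosisGenU K) = 1 := by
  change mitosisFreeDegree K (mitosisU K) = 1
  simp [mitosisFreeDegree, mitosisU]

theorem mitosisDegree_genT :
    mitosisDegree K (mitosisGenT K) = Multiplicative.ofAdd 1 := by
  change mitosisFreeDegree K (mitosisT K) = _
  simp [mitosisFreeDegree, mitosisT]

/-- The elements with exponent sum of `t` equal to zero or one. -/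
def LowDegree (a : Mitosis K) : Prop :=
  mitosisDegree K a = 1 ∨ mitosisDegree K a = Multiplicative.ofAdd 1

variable {K}

-- Nothing is assumed about the entries of `Θ`, yet those of `Θ'` have `t`-exponent 0 or 1: they are
-- values of the three homomorphisms, or the prism element.
open ListChain in
theorem exists_mitosis_step {G : Type u} [Group G] (j : G →* K)
    {Θ : ListChain G →ₗ[ℤ] ListChain K} (n : ℕ) (h0 : Θ (of []) = 0)
    (hΘ : ∀ l, l ≠ [] → l.length ≤ n → bd (Θ (of l)) + Θ (bd (of l)) = of (l.map j))
    (hs : ∀ l, l.length ≤ n →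
      SignedSum (fun l' => l'.length = l.length + 1) (excessFn l.length) (Θ (of l))) :
    ∃ Θ' : ListChain G →ₗ[ℤ] ListChain (Mitosis K), Θ' (of []) = 0 ∧
      (∀ l, l ≠ [] → l.length ≤ n + 1 →
        bd (Θ' (of l)) + Θ' (bd (of l)) = of (l.map ((mitosisHom K).comp j))) ∧
      ∀ l, l.length ≤ n + 1 → SignedSum (Entries (LowDegree K) (l.length + 1))
        (excessFn l.length) (Θ' (of l)) := by
  have hc := commute_mitosisHom_mitosisConj K
  have hγ := mitosisConj_genT K
  have hα : ∀ x, LowDegree K (mitosisHom K x) := fun x => .inl (mitosisDegree_mitosisHom K x)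
  have hy : ∀ y x, LowDegree K (mitosisConj K y x) := fun y x =>
    .inl (mitosisDegree_mitosisConj K y x)
  -- The element `t u⁻¹` conjugates `β` into `γ`; it is the only entry with exponent one.
  have hst : LowDegree K (mitosisGenT K * (mitosisGenU K)⁻¹) := .inr (by
    rw [map_mul, map_inv, mitosisDegree_genU, mitosisDegree_genT]; simp)
  refine ⟨stepHomotopy (mitosisHom K) (mitosisConj K (mitosisGenU K))
    (mitosisConj K (mitosisGenT K)) (mitosisGenT K * (mitosisGenU K)⁻¹) j Θ,
    stepHomotopy_nil, ?_, ?_⟩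
  · exact bd_stepHomotopy hc hγ (fun x => by simp [mitosisConj_apply, mul_assoc]) n h0 hΘ
      fun l hl => sgn_of_signedSum (hs l hl)
  · intro l hl
    cases l with
    | nil =>
      rw [stepHomotopy_nil]
      simpa [excessFn, gammaFn_zero] using SignedSum.zero
    | cons g l =>
      have h1 := signedSum_ez hα (hy (mitosisGenU K)) (hy (mitosisGenT K)) hγ ((g :: l).map j)
      have h2 := signedSum_prism (hy (mitosisGenU K)) (hy (mitosisGenT K)) hst ((g :: l).map j)
      have h3 := signedSum_frontShuffleList hα (hy (mitosisGenU K)) (j := j) hs (g :: l) hl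
      rw [List.length_map] at h1 h2
      convert (h1.sub h2).sub h3 using 1
      -- Guards the truncated subtraction when the Eilenberg–Zilber and prism counts are added.
      · have : l.length + 2 < 2 ^ (l.length + 2) := Nat.lt_two_pow_self
        simp only [List.length_cons, excessFn_succ]
        have e : l.length + 1 + 1 = l.length + 2 := rfl
        rw [e]
        omega
      · simp [stepHomotopy]

open ListChain in
theorem exists_mitosis_homotopy (G : Type u) [Group G] (n : ℕ) :
    ∃ Θ : ListChain G →ₗ[ℤ] ListChain (mitosisIter G n), Θ (of []) = 0 ∧
      (∀ l, l ≠ [] → l.length ≤ n →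
        bd (Θ (of l)) + Θ (bd (of l)) = of (l.map (mitosisEmb G n))) ∧
      ∀ l, l.length ≤ n → SignedSum (fun l' => l'.length = l.length + 1)
        (excessFn l.length) (Θ (of l)) := by
  induction n with
  | zero =>
    refine ⟨0, rfl, fun l hl hl' => absurd (List.length_eq_zero_iff.mp (by omega)) hl,
      fun l hl => ?_⟩
    have : l.length = 0 := by omega
    simpa [this, excessFn, gammaFn_zero] using SignedSum.zero
  | succ n ih =>
    obtain ⟨Θ, h0, h1, h2⟩ := ih
    obtain ⟨Θ', h0', h1', h2'⟩ := exists_mitosis_step (mitosisEmb G n) n h0 h1 h2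
    exact ⟨Θ', h0', h1', fun l hl => (h2' l hl).mono fun _ h => h.1⟩

end Mitosis

/-! ### Constant chains -/

namespace ListChain

variable {K A G : Type*} [Group A] [Group G]

/-- The list with `i` trivial entries, followed by `x` and `j` trivial entries. -/
def unitList (i : ℕ) (x : A) (j : ℕ) : List A := List.replicate i 1 ++ x :: List.replicate j 1

theorem length_unitList (i : ℕ) (x : A) (j : ℕ) : (unitList i x j).length = i + j + 1 := by
  simp [unitList]; omega

theorem unitList_succ (i : ℕ) (x : A) (j : ℕ) : unitList (i + 1) x j = 1 :: unitList i x j := rfl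

theorem inner_replicate (j : ℕ) :
    inner (of (List.replicate j (1 : A))) = if Odd j then - of (List.replicate (j - 1) 1) else 0 := by
  induction j with
  | zero => simp
  | succ j ih =>
    rw [List.replicate_succ, inner_of_cons, mulHeadList_one, ih]
    by_cases h : Odd j
    · have h' : ¬ Odd (j + 1) := by simpa [Nat.not_odd_iff_even] using h.add_one
      obtain ⟨i, rfl⟩ := h
      rw [if_pos ⟨i, rfl⟩, if_neg h', map_neg, cons_of]
      simp [List.replicate_succ]
    · have h' : Odd (j + 1) := (Nat.not_odd_iff_even.mp h).add_one
      simp [h, h']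

/-- Only the last face drops `x`; the other inner faces all coincide, and their alternating sum
depends on parity. -/
theorem inner_unitList_zero (i : ℕ) (x : A) :
    inner (of (unitList i x 0)) = if Odd i
      then of (List.replicate i 1) - of (unitList (i - 1) x 0)
      else - of (List.replicate i 1) := by
  induction i with
  | zero => simp [unitList]
  | succ i ih =>
    rw [unitList_succ, inner_of_cons, mulHeadList_one, ih]
    by_cases h : Odd i
    · have h' : ¬ Odd (i + 1) := by simpa [Nat.not_odd_iff_even] using h.add_one
      obtain ⟨i, rfl⟩ := h
      rw [if_pos ⟨i, rfl⟩, if_neg h', map_sub, cons_of, cons_of, Nat.add_sub_cancel,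
        ← unitList_succ, ← List.replicate_succ]
      abel
    · have h' : Odd (i + 1) := (Nat.not_odd_iff_even.mp h).add_one
      rw [if_neg h, if_pos h', map_neg, cons_of, Nat.add_sub_cancel, ← List.replicate_succ]
      abel

theorem bd_unitList_of_odd {m : ℕ} (hm : Odd m) (x : A) :
    bd (of (unitList m x 0)) = of (List.replicate m 1) := by
  rw [bd_apply, inner_unitList_zero, if_pos hm]
  obtain ⟨i, rfl⟩ := hm
  rw [unitList_succ, tail_of_cons, Nat.add_sub_cancel]
  abel

theorem bd_unitList_of_even {m : ℕ} (hm : Odd m) (x : A) :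
    bd (of (unitList (m + 1) x 0)) = of (unitList m x 0) - of (List.replicate (m + 1) 1) := by
  have : ¬ Odd (m + 1) := by simpa [Nat.not_odd_iff_even] using hm.add_one
  rw [bd_apply, inner_unitList_zero, if_neg this, unitList_succ, tail_of_cons]
  abel

theorem bd_unitList_one {m : ℕ} (hm : Odd m) (x : A) : bd (of (unitList 1 x m)) = 0 := by
  have h : inner (of (x :: List.replicate m 1)) = 0 := by
    rw [inner_of_cons, inner_replicate, if_pos hm]
    obtain ⟨i, rfl⟩ := hm
    simp [List.replicate_succ]
  rw [bd_apply, unitList_succ, tail_of_cons, inner_of_cons, mulHeadList_one]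
  simp [unitList, h]

/-- A chain of dimension `m + 1` with boundary `-[1, …, 1]` for odd `m`. -/
noncomputable def padOdd (x y : A) (N : ℤ) (m : ℕ) : ListChain A :=
  (N - 1) • of (unitList m x 0) - N • of (unitList m y 0)

/-- A sequence of chains on degenerate simplices, of diameters `d m` when the parities allow it. -/
noncomputable def pad (x y : A) (d : ℕ → ℕ) : ℕ → ListChain A
  | 0 => 0
  | m + 1 => if Odd (m + 1) then padOdd x y ((d (m + 1) + 1) / 2 : ℕ) (m + 1)
    else ((d (m + 1) : ℤ) - d m) • of (unitList 1 x m)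
      - padOdd x y ((d m + 1) / 2 : ℕ) (m + 1)

/-- The coefficients `N - 1` and `-N` add up to `-1` for every `N`, which leaves the diameter `2 * N
- 1` free. -/
theorem bd_pad_of_odd (x y : A) (d : ℕ → ℕ) {m : ℕ} (hm : Odd m) :
    bd (pad x y d m) = - of (List.replicate m 1) := by
  cases m with
  | zero => simp at hm
  | succ m =>
    rw [pad, if_pos hm, padOdd, map_sub, map_smul, map_smul, bd_unitList_of_odd hm,
      bd_unitList_of_odd hm]
    module

/-- The boundary forces the same `N` as in the preceding odd dimension. The diameter is adjusted by
a multiple of the cycle `[1, x, 1, …, 1]`. -/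
theorem bd_pad_of_even (x y : A) (d : ℕ → ℕ) {m : ℕ} (hm : Odd m) :
    bd (pad x y d (m + 1)) = - of (List.replicate (m + 1) 1) - pad x y d m := by
  have : ¬ Odd (m + 1) := by simpa [Nat.not_odd_iff_even] using hm.add_one
  rw [pad, if_neg this, map_sub, map_smul, bd_unitList_one hm, padOdd, map_sub, map_smul, map_smul,
    bd_unitList_of_even hm, bd_unitList_of_even hm]
  cases m with
  | zero => simp at hm
  | succ m =>
    rw [pad, if_pos hm, padOdd]
    module

variable {M : Type*} [AddCommGroup M]

theorem lin_length_inner (c : ℕ → M) (l : List G) :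
    lin (fun l : List G => c l.length) (inner (of l)) =
      if Odd l.length then - c (l.length - 1) else 0 := by
  induction l generalizing c with
  | nil => simp
  | cons g l ih =>
    have := ih (fun k => c (k + 1))
    rw [inner_of_cons, map_sub, map_neg, lin_of, lin_cons]
    simp only [List.length_cons, length_mulHeadList]
    rw [this]
    by_cases h : Odd l.length
    · have h' : ¬ Odd (l.length + 1) := by simpa [Nat.not_odd_iff_even] using h.add_one
      obtain ⟨i, hi⟩ := h
      rw [hi] at h' ⊢
      rw [if_pos ⟨i, rfl⟩, if_neg h']
      simp
    · have h' : Odd (l.length + 1) := (Nat.not_odd_iff_even.mp h).add_one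
      simp [h, h']

/-- A homotopy depending on dimension alone sees the alternating number of faces: 0 in odd and 1 in
even positive dimensions. The two boundary formulas for `pad` are made for these cases. -/
theorem bd_lin_pad (x y : A) (d : ℕ → ℕ) (l : List G) (hl : l ≠ []) :
    bd (pad x y d l.length) + lin (fun l : List G => pad x y d l.length) (bd (of l)) =
      - of (List.replicate l.length 1) := by
  obtain ⟨g, l, rfl⟩ := List.exists_cons_of_ne_nil hl
  rw [bd_apply (of _), map_add, lin_length_inner, tail_of_cons, lin_of, List.length_cons]
  by_cases h : Odd l.length
  · have h' : ¬ Odd (l.length + 1) := by simpa [Nat.not_odd_iff_even] using h.add_one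
    rw [if_neg h', bd_pad_of_even x y d h]
    abel
  · have h' : Odd (l.length + 1) := (Nat.not_odd_iff_even.mp h).add_one
    rw [if_pos h', bd_pad_of_odd x y d h', Nat.add_sub_cancel]
    abel

end ListChain

/-! ### Comparison of lists and simplices -/

section Transfer

open ListChain

variable {A : Type u} [Group A]

/-- The inclusion of the chains of dimension `m` into the chains on lists. -/
noncomputable def toListChain (G : Type u) (m : ℕ) : BChain G m →ₗ[ℤ] ListChain G :=
  Finsupp.lmapDomain ℤ ℤ List.ofFn

theorem toListChain_single {G : Type u} (m : ℕ) (σ : BSimplex G m) :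
    toListChain G m (Finsupp.single σ 1) = of (List.ofFn σ) := by
  simp [toListChain, of]

/-- The simplex of dimension `m` given by the first `m` entries of a list. -/
def listSimplex (m : ℕ) (l : List A) : BSimplex A m := fun i => l.getD i 1

/-- The retraction of the chains on lists onto the chains of dimension `m`. -/
noncomputable def ofListChain (A : Type u) [Group A] (m : ℕ) : ListChain A →ₗ[ℤ] BChain A m :=
  Finsupp.lmapDomain ℤ ℤ (listSimplex m)

theorem ofListChain_of (m : ℕ) (l : List A) :
    ofListChain A m (of l) = Finsupp.single (listSimplex m l) 1 := by
  simp [ofListChain, of]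

theorem listSimplex_ofFn (m : ℕ) (σ : BSimplex A m) : listSimplex m (List.ofFn σ) = σ := by
  funext i
  simp [listSimplex]

theorem ofFn_listSimplex (l : List A) : List.ofFn (listSimplex l.length l) = l := by
  refine List.ext_getElem (by simp) fun i h1 h2 => ?_
  simp [listSimplex, h2]

theorem ofListChain_toListChain (m : ℕ) (c : BChain A m) :
    ofListChain A m (toListChain A m c) = c := by
  have : ofListChain A m ∘ₗ toListChain A m = LinearMap.id :=
    Finsupp.lhom_ext' fun σ => LinearMap.ext_ring (by
      simp [toListChain_single, ofListChain_of, listSimplex_ofFn])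
  exact LinearMap.congr_fun this c

theorem ofFn_contractNth_succ {n : ℕ} (k : Fin (n + 1)) (σ : BSimplex A (n + 2)) :
    List.ofFn (Fin.contractNth k.succ (fun a b => a * b) σ) =
      σ 0 :: List.ofFn (Fin.contractNth k (fun a b => a * b) (Fin.tail σ)) := by
  rw [List.ofFn_succ]
  congr 2
  funext i
  simp [Fin.contractNth, Fin.tail]

theorem sum_contractNth (n : ℕ) (σ : BSimplex A (n + 1)) :
    ∑ j : Fin (n + 1), (-1 : ℤ) ^ ((j : ℕ) + 1) •
      of (List.ofFn (Fin.contractNth j (fun a b => a * b) σ)) = inner (of (List.ofFn σ)) := by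
  induction n with
  | zero => simp
  | succ n ih =>
    have h := congrArg (cons (σ 0)) (ih (Fin.tail σ))
    rw [map_sum] at h
    simp only [map_smul, cons_of] at h
    rw [Fin.sum_univ_succ, List.ofFn_succ (f := σ), inner_of_cons, sub_eq_add_neg]
    congr 1
    · rw [List.ofFn_succ (f := fun i => σ i.succ), mulHeadList_cons]
      have : List.ofFn (Fin.contractNth 0 (fun a b => a * b) σ) =
          (σ 0 * σ (Fin.succ 0)) :: List.ofFn fun i : Fin n => σ i.succ.succ := by
        rw [List.ofFn_succ]
        congr 2
      rw [this]
      simp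
    · have e : List.ofFn (fun i => σ i.succ) = List.ofFn (Fin.tail σ) := rfl
      rw [e, ← h, ← Finset.sum_neg_distrib]
      refine Finset.sum_congr rfl fun k _ => ?_
      rw [ofFn_contractNth_succ, Fin.val_succ, pow_succ _ ((k : ℕ) + 1)]
      simp

theorem toListChain_bBoundary (n : ℕ) (c : BChain A (n + 1)) :
    toListChain A n (bBoundary A n c) = bd (toListChain A (n + 1) c) := by
  have : toListChain A n ∘ₗ bBoundary A n = bd ∘ₗ toListChain A (n + 1) :=
    Finsupp.lhom_ext' fun σ => LinearMap.ext_ring (by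
      simp only [LinearMap.comp_apply, Finsupp.lsingle_apply, toListChain_single, bd_apply,
        bBoundary, LinearMap.sum_apply, LinearMap.smul_apply, map_sum, map_smul,
        Finsupp.lmapDomain_apply, Finsupp.mapDomain_single]
      rw [Fin.sum_univ_succ, ← sum_contractNth, List.ofFn_succ, tail_of_cons]
      simp [bFace]
      rfl)
  exact LinearMap.congr_fun this c

/-- Homogeneity is needed: the retraction truncates or pads lists of other lengths and is then no
chain map. -/
theorem bBoundary_ofListChain (n : ℕ) {N : ℕ} {c : ListChain A}
    (hc : SignedSum (fun l => l.length = n + 1) N c) :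
    bBoundary A n (ofListChain A (n + 1) c) = ofListChain A n (bd c) := by
  have h : toListChain A (n + 1) (ofListChain A (n + 1) c) = c :=
    hc.eq_of_forall (f := toListChain A (n + 1) ∘ₗ ofListChain A (n + 1)) (g := LinearMap.id)
      fun l hl => by
        have : ofListChain A (n + 1) (Finsupp.single l 1) =
          Finsupp.single (listSimplex (n + 1) l) 1 := ofListChain_of _ _
        rw [LinearMap.comp_apply, this, toListChain_single, ← hl, ofFn_listSimplex]
        rfl
  rw [← ofListChain_toListChain n (bBoundary A n _), toListChain_bBoundary, h]

end Transfer

/-! ### Diameters -/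

section Diameter

variable {G : Type u} {n : ℕ}

theorem chainDiam_add_of_disjoint {c d : BChain G n} (h : Disjoint c.support d.support) :
    chainDiam (c + d) = chainDiam c + chainDiam d :=
  Finsupp.sum_add_index_of_disjoint h _

theorem chainDiam_zero : chainDiam (0 : BChain G n) = 0 := Finsupp.sum_zero_index

theorem chainDiam_single (σ : BSimplex G n) (z : ℤ) :
    chainDiam (Finsupp.single σ z) = z.natAbs := Finsupp.sum_single_index rfl

theorem chainDiam_neg (c : BChain G n) : chainDiam (-c) = chainDiam c := by
  simp [chainDiam, Finsupp.sum_neg_index]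

theorem chainDiam_add_le (c d : BChain G n) : chainDiam (c + d) ≤ chainDiam c + chainDiam d := by
  classical
  have h (e : BChain G n) (he : e.support ⊆ c.support ∪ d.support) :
      chainDiam e = ∑ σ ∈ c.support ∪ d.support, (e σ).natAbs :=
    Finsupp.sum_of_support_subset e he _ fun _ _ => rfl
  rw [h _ Finsupp.support_add, h c Finset.subset_union_left, h d Finset.subset_union_right,
    ← Finset.sum_add_distrib]
  exact Finset.sum_le_sum fun σ _ => Int.natAbs_add_le _ _

theorem cast_chainDiam (c : BChain G n) :
    (chainDiam c : ZMod 2) = c.sum fun _ a => (a : ZMod 2) := by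
  rw [chainDiam, Finsupp.sum, Nat.cast_sum]
  refine Finset.sum_congr rfl fun σ _ => ?_
  rcases Int.natAbs_eq (c σ) with h | h
  · conv_rhs => rw [h]
    simp
  · conv_rhs => rw [h]
    simp [CharTwo.neg_eq]

theorem cast_chainDiam_add (c d : BChain G n) :
    (chainDiam (c + d) : ZMod 2) = chainDiam c + chainDiam d := by
  simp only [cast_chainDiam]
  exact Finsupp.sum_add_index' (fun _ => Int.cast_zero) fun _ _ _ => Int.cast_add _ _

theorem SignedSum.chainDiam_le {P : BSimplex G n → Prop} {N : ℕ} {c : BChain G n}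
    (h : SignedSum P N c) : chainDiam c ≤ N := by
  induction h with
  | zero => simp [chainDiam_zero]
  | pos _ _ ih =>
    refine (chainDiam_add_le _ _).trans (add_le_add ih ?_)
    simp [chainDiam_single]
  | neg _ _ ih =>
    rw [sub_eq_add_neg]
    refine (chainDiam_add_le _ _).trans (add_le_add ih ?_)
    simp [chainDiam_single, chainDiam_neg]

/-- Terms cancel in pairs, so the parity of the diameter is that of the uncancelled count. -/
theorem SignedSum.cast_chainDiam {P : BSimplex G n → Prop} {N : ℕ} {c : BChain G n}
    (h : SignedSum P N c) : (chainDiam c : ZMod 2) = N := by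
  induction h with
  | zero => simp [chainDiam_zero]
  | pos _ _ ih => simp [cast_chainDiam_add, ih, chainDiam_single]
  | neg _ _ ih =>
    rw [sub_eq_add_neg]
    simp [cast_chainDiam_add, ih, chainDiam_single, chainDiam_neg]

theorem SignedSum.disjoint_support {P Q : BSimplex G n → Prop} {N N' : ℕ} {c d : BChain G n}
    (hc : SignedSum P N c) (hd : SignedSum Q N' d) (h : ∀ σ, P σ → ¬ Q σ) :
    Disjoint c.support d.support := by
  rw [Finset.disjoint_left]
  intro σ h1 h2
  by_cases hσ : P σ
  · exact Finsupp.mem_support_iff.mp h2 (hd.apply_eq_zero (h σ hσ))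
  · exact Finsupp.mem_support_iff.mp h1 (hc.apply_eq_zero hσ)

variable [Group G]

theorem isDegenerate_of_eq_one {σ : BSimplex G (n + 1)} {i : Fin (n + 1)} (h : σ i = 1) :
    IsDegenerate σ :=
  ⟨i, i.removeNth σ, by rw [bDegen, ← h, Fin.insertNth_self_removeNth]⟩

theorem chainDiam_le_degenerateCount_add {c d : BChain G (n + 1)} {N : ℕ}
    (h : Disjoint c.support d.support) (hd : SignedSum IsDegenerate N d) :
    chainDiam d ≤ degenerateCount (c + d) := by
  classical
  have h1 : d.filter (fun σ => IsDegenerate σ) = d := by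
    rw [Finsupp.filter_eq_self_iff]
    intro σ hσ
    by_contra h2
    exact hσ (hd.apply_eq_zero h2)
  have h2 : Disjoint (c.filter fun σ => IsDegenerate σ).support d.support :=
    h.mono_left (by rw [Finsupp.support_filter]; exact Finset.filter_subset _ _)
  rw [degenerateCount, Finsupp.filter_add, h1, chainDiam_add_of_disjoint h2]
  exact Nat.le_add_left _ _

end Diameter

open ListChain

/-! ### The padding chains -/

section Padding

variable {A : Type u} [Group A]

theorem listSimplex_unitList (i j : ℕ) (x : A) (k : Fin (i + j + 1)) :
    listSimplex (i + j + 1) (unitList i x j) k = if (k : ℕ) = i then x else 1 := by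
  have hk := k.isLt
  simp only [listSimplex, unitList]
  rcases lt_trichotomy (k : ℕ) i with h | h | h
  · rw [if_neg h.ne, List.getD_append _ _ _ _ (by simpa using h)]; simp [h]
  · rw [if_pos h]; simp [h]
  · rw [if_neg h.ne', List.getD_append_right _ _ _ _ (by simpa using h.le)]
    obtain ⟨d, hd⟩ := Nat.exists_eq_add_of_lt h
    have e : (k : ℕ) - (List.replicate i (1 : A)).length = d + 1 := by simp; omega
    rw [e, List.getD_cons_succ]
    by_cases hdj : d < j <;> simp [hdj]

/-- The simplex with `x` in position `i` and all other entries trivial. -/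
def unitSimplex (m i : ℕ) (x : A) : BSimplex A (m + 1) := fun k => if (k : ℕ) = i then x else 1

theorem listSimplex_unitList_zero (m : ℕ) (x : A) :
    listSimplex (m + 1) (unitList m x 0) = unitSimplex m m x :=
  funext fun k => listSimplex_unitList m 0 x k

theorem listSimplex_unitList_one (m : ℕ) (x : A) :
    listSimplex (m + 2) (unitList 1 x m) = unitSimplex (m + 1) 1 x := by
  funext k
  have h := listSimplex_unitList 1 m x (k.cast (by omega))
  simpa [listSimplex, unitSimplex] using h

theorem signedSum_smul_single {X : Type*} {P : X → Prop} {x : X} (h : P x) (z : ℤ) :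
    SignedSum P z.natAbs (z • Finsupp.single x 1) := by
  have hn : ∀ n : ℕ, SignedSum P n ((n : ℤ) • Finsupp.single x (1 : ℤ)) := by
    intro n
    induction n with
    | zero => simpa using SignedSum.zero
    | succ n ih =>
      rw [Nat.cast_succ, add_smul, one_smul]
      exact .pos h ih
  rcases Int.natAbs_eq z with hz | hz
  · conv => rw [hz]
    rw [Int.natAbs_natCast]
    exact hn _
  · conv => rw [hz]
    rw [Int.natAbs_neg, Int.natAbs_natCast, neg_smul]
    exact (hn _).opp

theorem signedSum_padOdd {X : Type*} {P : X → Prop} (φ : ListChain A →ₗ[ℤ] (X →₀ ℤ))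
    {x y : A} {m : ℕ} {a b : X} (ha : φ (of (unitList m x 0)) = Finsupp.single a 1)
    (hb : φ (of (unitList m y 0)) = Finsupp.single b 1) (hPa : P a) (hPb : P b) (N : ℤ) :
    SignedSum P ((N - 1).natAbs + N.natAbs) (φ (padOdd x y N m)) := by
  rw [padOdd, map_sub, map_smul, map_smul, ha, hb]
  exact (signedSum_smul_single hPa _).sub (signedSum_smul_single hPb _)

/-- Kept general in `φ` to serve both for lengths of lists and for simplices. The conditions on `i`
and `j` force a trivial first entry, hence degeneracy. -/
theorem exists_signedSum_pad {X : Type*} {P : X → Prop} (φ : ListChain A →ₗ[ℤ] (X →₀ ℤ))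
    (x y : A) (d : ℕ → ℕ) (m : ℕ)
    (hφ : ∀ i z j, (z = x ∨ z = y) → i + j = m → 1 ≤ m → (j = 0 ∨ i = 1) →
      ∃ a, P a ∧ φ (of (unitList i z j)) = Finsupp.single a 1) :
    ∃ N, SignedSum P N (φ (pad x y d m)) := by
  cases m with
  | zero => exact ⟨0, by simpa [pad] using SignedSum.zero⟩
  | succ m =>
    obtain ⟨a, hPa, ha⟩ := hφ (m + 1) x 0 (.inl rfl) rfl (by omega) (.inl rfl)
    obtain ⟨b, hPb, hb⟩ := hφ (m + 1) y 0 (.inr rfl) rfl (by omega) (.inl rfl)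
    obtain ⟨c, hPc, hc⟩ := hφ 1 x m (.inl rfl) (by omega) (by omega) (.inr rfl)
    rw [pad]
    split_ifs
    · exact ⟨_, signedSum_padOdd φ ha hb hPa hPb _⟩
    · rw [map_sub, map_smul, hc]
      exact ⟨_, (signedSum_smul_single hPc _).sub (signedSum_padOdd φ ha hb hPa hPb _)⟩

theorem signedSum_length_pad (x y : A) (d : ℕ → ℕ) (m : ℕ) :
    ∃ N, SignedSum (fun l => l.length = m + 1) N (pad x y d m) :=
  exists_signedSum_pad LinearMap.id x y d m fun i z j _ h _ _ =>
    ⟨unitList i z j, by rw [length_unitList, h], rfl⟩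

theorem signedSum_simplex_pad (E : A → Prop) {x y : A} (hx : ¬ E x) (hy : ¬ E y) (d : ℕ → ℕ)
    (m : ℕ) :
    ∃ N, SignedSum (fun σ : BSimplex A (m + 1) => IsDegenerate σ ∧ ∃ k, ¬ E (σ k)) N
      (ofListChain A (m + 1) (pad x y d m)) := by
  refine exists_signedSum_pad (ofListChain A (m + 1)) x y d m fun i z j hz h hm hij => ?_
  subst h
  refine ⟨_, ⟨?_, ⟨⟨i, by omega⟩, ?_⟩⟩, ofListChain_of _ _⟩
  · rcases hij with rfl | rfl
    · exact isDegenerate_of_eq_one (i := ⟨0, by omega⟩)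
        ((listSimplex_unitList i 0 z ⟨0, by omega⟩).trans (if_neg (by simp at hm ⊢; omega)))
    · exact isDegenerate_of_eq_one (i := ⟨0, by omega⟩)
        ((listSimplex_unitList 1 j z ⟨0, by omega⟩).trans (if_neg (by simp)))
  · rw [listSimplex_unitList, if_pos rfl]
    rcases hz with rfl | rfl <;> assumption

theorem unitSimplex_injective {m i : ℕ} (hi : i ≤ m) {x y : A}
    (h : unitSimplex m i x = unitSimplex m i y) : x = y := by
  simpa [unitSimplex] using congrFun h ⟨i, by omega⟩

theorem chainDiam_padOdd {x y : A} (hxy : x ≠ y) (m : ℕ) (N : ℕ) (hN : 1 ≤ N) :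
    chainDiam (ofListChain A (m + 1) (padOdd x y N m)) = 2 * N - 1 := by
  have hne : unitSimplex m m x ≠ unitSimplex m m y := fun h =>
    hxy (unitSimplex_injective le_rfl h)
  have h1 := signedSum_smul_single (P := (· = unitSimplex m m x)) rfl ((N : ℤ) - 1)
  have h2 := (signedSum_smul_single (P := (· = unitSimplex m m y)) rfl (N : ℤ)).opp
  rw [padOdd, map_sub, map_smul, map_smul, ofListChain_of, ofListChain_of,
    listSimplex_unitList_zero, listSimplex_unitList_zero, sub_eq_add_neg,
    chainDiam_add_of_disjoint (h1.disjoint_support h2 fun σ h h' => hne (h.symm.trans h')),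
    chainDiam_neg, Finsupp.smul_single, Finsupp.smul_single, chainDiam_single, chainDiam_single]
  simp only [smul_eq_mul, mul_one]
  omega

theorem chainDiam_pad {x y : A} (hx : x ≠ 1) (hxy : x ≠ y) (d : ℕ → ℕ) (h0 : d 0 = 0)
    (hodd : ∀ m, Odd m → Odd (d m)) (hd : ∀ m, d m ≤ d (m + 1)) (m : ℕ) :
    chainDiam (ofListChain A (m + 1) (pad x y d m)) = d m := by
  cases m with
  | zero => simp [pad, chainDiam_zero, h0]
  | succ m =>
    rw [pad]
    split_ifs with hm
    · obtain ⟨i, hi⟩ := hodd _ hm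
      rw [chainDiam_padOdd hxy _ _ (by omega)]
      omega
    · have hm' : Odd m := by
        rw [Nat.odd_add_one, not_not] at hm
        exact hm
      obtain ⟨i, hi⟩ := hodd _ hm'
      -- Since `m` is odd, positions 1 and `m + 1` differ, so the cycle does not meet the rest and
      -- the diameters add: `(d (m + 1) - d m) + d m`.
      have hne : ∀ z, unitSimplex (m + 1) 1 x ≠ unitSimplex (m + 1) (m + 1) z := fun z h => by
        have h1 := congrFun h ⟨1, by omega⟩
        have h2 : m ≠ 0 := by rintro rfl; simp at hm'
        simp [unitSimplex, h2] at h1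
        exact hx h1
      have h1 := signedSum_smul_single (P := (· = unitSimplex (m + 1) 1 x)) rfl
        ((d (m + 1) : ℤ) - d m)
      have h2 := signedSum_padOdd (P := fun σ => ∃ z, σ = unitSimplex (m + 1) (m + 1) z)
        (ofListChain A (m + 2)) (x := x) (y := y) (m := m + 1)
        ((ofListChain_of _ _).trans (by rw [listSimplex_unitList_zero]))
        ((ofListChain_of _ _).trans (by rw [listSimplex_unitList_zero]))
        ⟨_, rfl⟩ ⟨_, rfl⟩ ((d m + 1) / 2 : ℕ)
      rw [map_sub, map_smul, ofListChain_of, listSimplex_unitList_one, sub_eq_add_neg,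
        chainDiam_add_of_disjoint (h1.disjoint_support h2.opp ?_), chainDiam_neg,
        chainDiam_padOdd hxy _ _ (by omega), Finsupp.smul_single, chainDiam_single]
      · have := hd m
        simp only [smul_eq_mul, mul_one]
        omega
      · rintro σ h ⟨z, hz⟩
        exact hne z (h.symm.trans hz)

end Padding

/-! ### The partial chain homotopy -/

section Homotopy

variable {G A : Type u} [Group G] [Group A]

theorem toListChain_bMap (f : G →* A) (m : ℕ) (c : BChain G m) :
    toListChain A m (bMap f m c) = ListChain.map f (toListChain G m c) := by
  have : toListChain A m ∘ₗ bMap f m = ListChain.map f ∘ₗ toListChain G m :=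
    Finsupp.lhom_ext' fun σ => LinearMap.ext_ring (by
      simp only [LinearMap.comp_apply, Finsupp.lsingle_apply, toListChain_single, bMap,
        Finsupp.lmapDomain_apply, Finsupp.mapDomain_single, map_of, List.map_ofFn]
      rfl)
  exact LinearMap.congr_fun this c

/-- The partial chain homotopy on simplices given by a chain homotopy on lists. -/
noncomputable def homotopyOfList (f g : G →* A) (n : ℕ) (Ψ : ListChain G →ₗ[ℤ] ListChain A)
    (h0 : Ψ (of []) = 0)
    (hlen : ∀ l, l.length ≤ n → ∃ N, SignedSum (fun l' => l'.length = l.length + 1) N (Ψ (of l)))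
    (hΨ : ∀ l, l ≠ [] → l.length ≤ n →
      bd (Ψ (of l)) + Ψ (bd (of l)) = of (l.map g) - of (l.map f)) :
    PartialChainHomotopy f g n where
  map m _ := ofListChain A (m + 1) ∘ₗ Ψ ∘ₗ toListChain G m
  zero_comm := Finsupp.lhom_ext' fun σ => LinearMap.ext_ring (by
    -- There is only one 0-simplex, so both chain maps agree there.
    have h : (fun k => g (σ k)) = fun k => f (σ k) := Subsingleton.elim _ _
    simp [toListChain_single, h0, bMap, h])
  succ_comm m hm := Finsupp.lhom_ext' fun σ => LinearMap.ext_ring (by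
    obtain ⟨N, hN⟩ := hlen (List.ofFn σ) (by simpa using hm)
    rw [List.length_ofFn] at hN
    have h1 := congrArg (ofListChain A (m + 1))
      (hΨ (List.ofFn σ) (by simp) (by simpa using hm))
    simp only [LinearMap.comp_apply, LinearMap.add_apply, LinearMap.sub_apply,
      Finsupp.lsingle_apply, toListChain_bBoundary, toListChain_single,
      bBoundary_ofListChain _ hN]
    rw [← map_add, h1, ← ofListChain_toListChain (m + 1) (bMap g (m + 1) _),
      ← ofListChain_toListChain (m + 1) (bMap f (m + 1) _), toListChain_bMap, toListChain_bMap,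
      toListChain_single, map_of, map_of, map_sub])

theorem homotopyOfList_onSimplex (f g : G →* A) (n : ℕ) (Ψ : ListChain G →ₗ[ℤ] ListChain A)
    (h0) (hlen) (hΨ) (m : ℕ) (hm : m ≤ n) (σ : BSimplex G m) :
    (homotopyOfList f g n Ψ h0 hlen hΨ).onSimplex m hm σ =
      ofListChain A (m + 1) (Ψ (of (List.ofFn σ))) := by
  simp [PartialChainHomotopy.onSimplex, homotopyOfList, toListChain_single]

/-- A homotopy on lists from zero to `g` in positive dimensions, with at most `excessFn m` terms in
dimension `m`, can be completed to a partial chain homotopy from the trivial map to `g` with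
the diameter function `gammaFn` and at least `qFn m` degenerate simplices. The constant part of the
homotopy, which contracts the trivial map, consists of degenerate simplices; the number of its
terms accounts for the terms of `Θ` that cancel on every simplex (as they do for trivial `G`). -/
theorem exists_partialChainHomotopy (g : G →* A) (n : ℕ) (E : A → Prop) {x y : A} (hx1 : x ≠ 1)
    (hxy : x ≠ y) (hx : ¬ E x) (hy : ¬ E y) (Θ : ListChain G →ₗ[ℤ] ListChain A)
    (h0 : Θ (of []) = 0)
    (hΘ : ∀ l, l ≠ [] → l.length ≤ n → bd (Θ (of l)) + Θ (bd (of l)) = of (l.map g))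
    (hs : ∀ l, l.length ≤ n →
      SignedSum (Entries E (l.length + 1)) (excessFn l.length) (Θ (of l))) :
    ∃ Ψ : PartialChainHomotopy (1 : G →* A) g n,
      (∀ (m : ℕ) (hm : m ≤ n), Ψ.HasDiameter m hm (gammaFn m)) ∧
      (∀ (m : ℕ) (hm : m ≤ n) (σ : BSimplex G m),
        qFn m ≤ degenerateCount (Ψ.onSimplex m hm σ)) := by
  have hsm : ∀ (m : ℕ), m ≤ n → ∀ σ : BSimplex G m,
      SignedSum (fun τ : BSimplex A (m + 1) => ∀ k, E (τ k)) (excessFn m)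
        (ofListChain A (m + 1) (Θ (of (List.ofFn σ)))) := by
    intro m hm σ
    have h := hs (List.ofFn σ) (by simpa using hm)
    rw [List.length_ofFn] at h
    simpa using h.bind (N' := 1) (ofListChain A (m + 1)) fun l hl => by
      have e : ofListChain A (m + 1) (Finsupp.single l 1) = _ := ofListChain_of (m + 1) l
      rw [e]
      refine .single fun k => ?_
      have hk : (k : ℕ) < l.length := by rw [hl.1]; exact k.isLt
      simpa [listSimplex, hk] using hl.2 _ (List.getElem_mem hk)
  have hmax : ∀ m : ℕ, ∃ μ, μ ≤ excessFn m ∧ (μ : ZMod 2) = excessFn m ∧ (m ≤ n →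
      IsGreatest (Set.range fun σ : BSimplex G m =>
        chainDiam (ofListChain A (m + 1) (Θ (of (List.ofFn σ))))) μ) := by
    intro m
    by_cases hm : m ≤ n
    · obtain ⟨μ, hμ⟩ := BddAbove.exists_isGreatest_of_nonempty
        (S := Set.range fun σ : BSimplex G m =>
          chainDiam (ofListChain A (m + 1) (Θ (of (List.ofFn σ)))))
        ⟨excessFn m, by rintro _ ⟨σ, rfl⟩; exact (hsm m hm σ).chainDiam_le⟩
        ⟨_, ⟨fun _ => 1, rfl⟩⟩
      obtain ⟨σ, hσ⟩ := hμ.1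
      exact ⟨μ, hσ ▸ (hsm m hm σ).chainDiam_le, hσ ▸ (hsm m hm σ).cast_chainDiam,
        fun _ => hμ⟩
    · exact ⟨excessFn m, le_rfl, rfl, fun h => absurd h hm⟩
  choose μ hμ hμ2 hμmax using hmax
  have hadd : ∀ m, (gammaFn m - μ m) + μ m = gammaFn m := fun m =>
    Nat.sub_add_cancel ((hμ m).trans (Nat.sub_le _ _))
  obtain ⟨d, hd⟩ : ∃ d : ℕ → ℕ, ∀ m, d m + μ m = gammaFn m := ⟨_, hadd⟩
  have hdq : ∀ m, qFn m ≤ d m := fun m => by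
    have h1 := hd m
    have h2 := excessFn_add_qFn m
    have h3 := hμ m
    omega
  have hd0 : d 0 = 0 := by
    have := hd 0
    rw [gammaFn_zero] at this
    omega
  have hodd : ∀ m, Odd m → Odd (d m) := fun m hm => by
    have h1 := congrArg (Nat.cast (R := ZMod 2)) ((hd m).trans (excessFn_add_qFn m).symm)
    rw [Nat.cast_add, Nat.cast_add, hμ2, add_comm, add_left_cancel_iff,
      ZMod.natCast_eq_one_iff_odd.mpr (odd_qFn hm)] at h1
    exact ZMod.natCast_eq_one_iff_odd.mp h1
  -- The chain is `d(m) ≤ γ(m) ≤ q(m + 1) ≤ d(m + 1)`.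
  have hdmono : ∀ m, d m ≤ d (m + 1) := fun m =>
    ((Nat.le_add_right _ _).trans (hd m).le).trans ((gammaFn_le_qFn_succ m).trans (hdq _))
  let Ψ : ListChain G →ₗ[ℤ] ListChain A := Θ + lin fun l => pad x y d l.length
  have hΨof : ∀ l, Ψ (of l) = Θ (of l) + pad x y d l.length := fun l => by simp [Ψ]
  have hΨ0 : Ψ (of []) = 0 := by simp [hΨof, h0, pad]
  have hlen : ∀ l, l.length ≤ n →
      ∃ N, SignedSum (fun l' => l'.length = l.length + 1) N (Ψ (of l)) := fun l hl => by
    obtain ⟨N, hN⟩ := signedSum_length_pad x y d l.length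
    exact ⟨_, hΨof l ▸ ((hs l hl).mono fun _ h => h.1).add hN⟩
  have hΨ : ∀ l, l ≠ [] → l.length ≤ n →
      bd (Ψ (of l)) + Ψ (bd (of l)) = of (l.map g) - of (l.map (1 : G →* A)) := by
    intro l hl hl'
    have h1 := hΘ l hl hl'
    have h2 := bd_lin_pad x y d l hl
    have h3 : l.map (1 : G →* A) = List.replicate l.length 1 := by
      rw [List.eq_replicate_iff]
      simp
    rw [hΨof, h3]
    simp only [Ψ, LinearMap.add_apply, map_add]
    linear_combination (norm := module) h1 + h2
  refine ⟨homotopyOfList 1 g n Ψ hΨ0 hlen hΨ, ?_, ?_⟩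
  all_goals
    have hsum : ∀ (m : ℕ) (hm : m ≤ n) (σ : BSimplex G m),
        (homotopyOfList 1 g n Ψ hΨ0 hlen hΨ).onSimplex m hm σ =
          ofListChain A (m + 1) (Θ (of (List.ofFn σ))) +
            ofListChain A (m + 1) (pad x y d m) := fun m hm σ => by
      rw [homotopyOfList_onSimplex, hΨof, map_add, List.length_ofFn]
    have hpad := chainDiam_pad hx1 hxy d hd0 hodd hdmono
    have hdisj : ∀ (m : ℕ), m ≤ n → ∀ σ : BSimplex G m,
        Disjoint (ofListChain A (m + 1) (Θ (of (List.ofFn σ)))).support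
          (ofListChain A (m + 1) (pad x y d m)).support := fun m hm σ => by
      obtain ⟨N, hN⟩ := signedSum_simplex_pad E hx hy d m
      exact (hsm m hm σ).disjoint_support hN fun τ h h' => h'.2.elim fun k hk => hk (h k)
  · intro m hm
    constructor
    · obtain ⟨σ, hσ⟩ := (hμmax m hm).1
      refine ⟨m, le_rfl, σ, ?_⟩
      rw [hsum, chainDiam_add_of_disjoint (hdisj m hm σ), hpad, ← hd, add_comm, ← hσ]
    · rintro _ ⟨i, hi, σ, rfl⟩
      rw [hsum, chainDiam_add_of_disjoint (hdisj i (hi.trans hm) σ), hpad]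
      refine le_trans ?_ (gammaFn_mono hi)
      rw [← hd i, add_comm]
      exact Nat.add_le_add_left ((hμmax i (hi.trans hm)).2 ⟨σ, rfl⟩) _
  · intro m hm σ
    obtain ⟨N, hN⟩ := signedSum_simplex_pad E hx hy d m
    rw [hsum]
    exact (hdq m).trans ((hpad m).ge.trans
      (chainDiam_le_degenerateCount_add (hdisj m hm σ) (hN.mono fun _ h => h.1)))

/-- For `n = 0` there is no generator `t`, but the zero homotopy suffices. For `n > 0` the last
mitosis step is made outside the induction, to retain the bound on the `t`-exponents of the entries.
-/
theorem exists_partialChainHomotopy_mitosisEmb (G : Type u) [Group G] (n : ℕ) :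
    ∃ Ψ : PartialChainHomotopy (1 : G →* mitosisIter G n) (mitosisEmb G n) n,
      (∀ (m : ℕ) (hm : m ≤ n), Ψ.HasDiameter m hm (gammaFn m)) ∧
      (∀ (m : ℕ) (hm : m ≤ n) (σ : BSimplex G m),
        qFn m ≤ degenerateCount (Ψ.onSimplex m hm σ)) := by
  cases n with
  | zero =>
    have hΨ : ∀ l : List G, l ≠ [] → l.length ≤ 0 → bd ((0 : ListChain G →ₗ[ℤ]
        ListChain (mitosisIter G 0)) (of l)) + (0 : ListChain G →ₗ[ℤ] _) (bd (of l)) =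
          of (l.map (mitosisEmb G 0)) - of (l.map (1 : G →* mitosisIter G 0)) :=
      fun l hl hl' => absurd (List.length_eq_zero_iff.mp (by omega)) hl
    refine ⟨homotopyOfList 1 (mitosisEmb G 0) 0 0 rfl (fun l _ => ⟨0, .zero⟩) hΨ, ?_, ?_⟩
    · intro m hm
      obtain rfl : m = 0 := by omega
      rw [gammaFn_zero]
      constructor
      · refine ⟨0, le_rfl, Fin.elim0, ?_⟩
        rw [homotopyOfList_onSimplex, LinearMap.zero_apply, map_zero, chainDiam_zero]
      · rintro _ ⟨i, hi, σ, rfl⟩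
        rw [homotopyOfList_onSimplex, LinearMap.zero_apply, map_zero, chainDiam_zero]
    · intro m hm σ
      obtain rfl : m = 0 := by omega
      rw [qFn_zero]
      exact Nat.zero_le _
  | succ n =>
    let K := mitosisIter G n
    obtain ⟨Θ, h0, h1, h2⟩ := exists_mitosis_homotopy G n
    obtain ⟨Θ', h0', h1', h2'⟩ := exists_mitosis_step (mitosisEmb G n) n h0 h1 h2
    have hdeg : ∀ k : ℕ, mitosisDegree K (mitosisGenT K ^ k) = Multiplicative.ofAdd (k : ℤ) := by
      intro k
      rw [map_pow, mitosisDegree_genT, ← ofAdd_nsmul]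
      simp
    -- The padding entries are `t²` and `t³`: distinct, nontrivial, and never entries of `Θ'`.
    have hlow : ∀ k : ℕ, 2 ≤ k → ¬ LowDegree K (mitosisGenT K ^ k) := by
      rintro k hk (h | h) <;> rw [hdeg] at h
      · have := congrArg Multiplicative.toAdd h
        simp at this; omega
      · have := congrArg Multiplicative.toAdd h
        simp at this; omega
    have hne : mitosisGenT K ^ 2 ≠ mitosisGenT K ^ 3 := fun h => by
      have h3 := congrArg (mitosisDegree K) h
      rw [hdeg, hdeg] at h3
      have := congrArg Multiplicative.toAdd h3
      simp at this
    exact exists_partialChainHomotopy (A := Mitosis K) _ (n + 1) (LowDegree K)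
      (fun h => hlow 2 le_rfl (.inl (by rw [h, map_one]))) hne (hlow 2 le_rfl) (hlow 3 (by omega))
      Θ' h0' h1' h2'

end Homotopy

/-! ### The recurrences, the tabulated values and the homotopies together. -/

theorem theorem4p2 :
    -- the recurrence formulas
    (∀ m : ℕ, 1 ≤ m → gammaFn m = 2 ^ m * (m + 1) +
      ∑ k ∈ Finset.Icc 1 (m - 1), gammaFn k * Nat.choose (m + 1) (m - k)) ∧
    (∀ m : ℕ, 1 ≤ m → qFn m = 2 ^ m * (m - 1) + 1 +
      ∑ k ∈ Finset.Icc 1 (m - 1), qFn k * Nat.choose (m + 1) (m - k)) ∧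
    -- the values for `m = 0, …, 7`
    (List.range 8).map gammaFn = [0, 4, 24, 152, 1120, 9732, 98336, 1135024] ∧
    (List.range 8).map qFn = [0, 1, 8, 55, 414, 3613, 36532, 421699] ∧
    -- the partial chain homotopies between the trivial map and the mitosis embedding
    ∀ (G : Type u) [Group G] (n : ℕ),
      ∃ Ψ : PartialChainHomotopy (1 : G →* mitosisIter G n) (mitosisEmb G n) n,
        (∀ (m : ℕ) (hm : m ≤ n), Ψ.HasDiameter m hm (gammaFn m)) ∧
        (∀ (m : ℕ) (hm : m ≤ n) (σ : BSimplex G m),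
          qFn m ≤ degenerateCount (Ψ.onSimplex m hm σ)) := by
  refine ⟨fun m hm => ?_, fun m hm => ?_, ?_, ?_, fun G _ n =>
    exists_partialChainHomotopy_mitosisEmb G n⟩
  · obtain ⟨m, rfl⟩ := Nat.exists_eq_add_of_le' hm
    rw [gammaFn_succ, sum_range_eq_sum_Icc, Nat.add_sub_cancel]
  · obtain ⟨m, rfl⟩ := Nat.exists_eq_add_of_le' hm
    rw [qFn_succ, sum_range_eq_sum_Icc, Nat.add_sub_cancel]
  · have h0 := gammaFn_zero
    have h1 := gammaFn_succ 0
    have h2 := gammaFn_succ 1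
    have h3 := gammaFn_succ 2
    have h4 := gammaFn_succ 3
    have h5 := gammaFn_succ 4
    have h6 := gammaFn_succ 5
    have h7 := gammaFn_succ 6
    norm_num [Finset.sum_range_succ, Nat.choose] at h1 h2 h3 h4 h5 h6 h7
    norm_num [h1] at h2
    norm_num [h1, h2] at h3
    norm_num [h1, h2, h3] at h4
    norm_num [h1, h2, h3, h4] at h5
    norm_num [h1, h2, h3, h4, h5] at h6
    norm_num [h1, h2, h3, h4, h5, h6] at h7
    simp [List.range_succ, h0, h1, h2, h3, h4, h5, h6, h7]
  · have h0 := qFn_zero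
    have h1 := qFn_succ 0
    have h2 := qFn_succ 1
    have h3 := qFn_succ 2
    have h4 := qFn_succ 3
    have h5 := qFn_succ 4
    have h6 := qFn_succ 5
    have h7 := qFn_succ 6
    norm_num [Finset.sum_range_succ, Nat.choose] at h1 h2 h3 h4 h5 h6 h7
    norm_num [h1] at h2
    norm_num [h1, h2] at h3
    norm_num [h1, h2, h3] at h4
    norm_num [h1, h2, h3, h4] at h5
    norm_num [h1, h2, h3, h4, h5] at h6
    norm_num [h1, h2, h3, h4, h5, h6] at h7
    simp [List.range_succ, h0, h1, h2, h3, h4, h5, h6, h7]
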